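/- Let $m,p\ge 1$, $n=m+p$; write $v=(v_-,v_+)\in\mathbb R^m\times\mathbb R^p$ and split $n\times n$ matrices into blocks accordingly. **Data.** Let $\Lambda=\mathrm{diag}(\lambda_1,\dots,\lambda_n)$ be $C^1$ on $\mathbb R^2$, with $\Lambda$ and $\partial_x\Lambda$ bounded, and suppose that there is $\epsilon>0$ such that on $\mathbb R^2$ $$\lambda_1<\dots<\lambda_m<-\epsilon<0<\epsilon<\lambda_{m+1}<\dots<\lambda_n,\qquad \lambda_{i+1}-\lambda_i>\epsilon\quad(1\le i\le n-1).$$ (Speeds given only on $[0,+\infty)\times[0,1]$ are first extended to $\mathbb R^2$ with these properties.) Let $Q^1:[0,+\infty)\to\mathbb R^{p\times m}$ be continuous and bounded, let $G^2_{--}$ and $G^2_{+-}$ be continuous bounded functions on $[0,+\infty)\times[0,1]$ with values in $\mathbb R^{m\times m}$ and $\mathbb R^{p\times m}$, with $G^2_{--}=(g^2_{ij})$ strictly lower triangular, and put $$G^2=\begin{pmatrix}G^2_{--}&0\\ G^2_{+-}&0\end{pmatrix},\qquad G^3=\begin{pmatrix}0&0\\ G^2_{+-}&0\end{pmatrix}.$$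 **Characteristics.** $\chi_i(\cdot;t,x)$ is the solution of $\partial_s\chi_i=\lambda_i(s,\chi_i)$ on $\mathbb R$ with $\chi_i(t;t,x)=x$. For $x\in[0,1]$, $s_i^{in}(t,x)$ and $s_i^{out}(t,x)$ are the times $s$ at which $\chi_i(s;t,x)$ equals $1$ and $0$ respectively if $i\le m$, and $0$ and $1$ respectively if $i>m$. **Broad solutions.** Let $t^0\ge0$, $y^0\in L^2(0,1)^n$. A function $y$ is a broad solution of the system $(0,G,F,Q)$, $$\partial_ty+\Lambda\,\partial_xy=G(t,x)\,y(t,0),\quad y_-(t,1)=\int_0^1F(t,\xi)y(t,\xi)\,d\xi,\quad y_+(t,0)=Q(t)y_-(t,0),\quad y(t^0,\cdot)=y^0,$$ if $y\in C^0([t^0,t^0+T];L^2(0,1)^n)\cap C^0([0,1];L^2(t^0,t^0+T)^n)$ for all $T>0$ and, for every $i$ and a.e. $(t,x)\in(t^0,+\infty)\times(0,1)$, $$y_i(t,x)=b_i(y)(t,x)+\sum_{j=1}^n\int_{\max\{t^0,s_i^{in}(t,x)\}}^t g_{ij}(s,\chi_i(s;t,x))\,y_j(s,0)\,ds.$$ Here,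 with $\sigma=s_i^{in}(t,x)$: $b_i(y)(t,x)=\sum_{j=1}^n\int_0^1f_{ij}(\sigma,\xi)y_j(\sigma,\xi)\,d\xi$ if $\sigma>t^0$ and $i\le m$; $b_i(y)(t,x)=\sum_{j=1}^m q_{i-m,j}(\sigma)y_j(\sigma,0)$ if $\sigma>t^0$ and $i>m$; and $b_i(y)(t,x)=y^0_i(\chi_i(t^0;t,x))$ if $\sigma<t^0$. **Kernel and gain.** Let $H=\begin{pmatrix}H_{--}&0\\0&0\end{pmatrix}$, $H_{--}=(h_{ij})_{1\le i,j\le m}$, where $h_{ij}$ solves the following along characteristics: for all $t>0$, $x,\xi\in(0,1)$ with $s^{out}_i(t,x)\ne s^{out}_j(t,\xi)$, the function $\eta(s)=h_{ij}(s,\chi_i(s;t,x),\chi_j(s;t,\xi))$ satisfies $$\eta'(s)=-\partial_x\lambda_j(s,\chi_j(s;t,\xi))\,\eta(s)\quad\text{for } s\in\bigl[\max\{0,s^{in}_i(t,x),s^{in}_j(t,\xi)\},\ \min\{s^{out}_i(t,x),s^{out}_j(t,\xi)\}\bigr],$$ and the value of $\eta$ at the right endpoint is $0$ if $s^{out}_i(t,x)<s^{out}_j(t,\xi)$,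 and $-g^2_{ij}(\tau,\chi_i(\tau;t,x))/\lambda_j(\tau,0)$ with $\tau=s^{out}_j(t,\xi)$ if $s^{out}_i(t,x)>s^{out}_j(t,\xi)$. (The kernel is in general discontinuous across $s_i^{out}(t,x)=s_j^{out}(t,\xi)$.) Let $F^2\in L^\infty((0,+\infty)\times(0,1))^{m\times n}$ be the solution of $$F^2(t,\xi)-\int_0^1F^2(t,\zeta)H(t,\zeta,\xi)\,d\zeta=-H_-(t,1,\xi)\qquad\text{for a.e. }(t,\xi),$$ where $H_-$ is formed by the first $m$ rows of $H$. **Proposition.** Let $t^0\ge0$, $z^0\in L^2(0,1)^n$, and let $z$ be the broad solution of $(0,G^3,0,Q^1)$ with initial data $z^0$ at time $t^0$. Then $$\gamma(t,x)=z(t,x)-\int_0^1H(t,x,\xi)z(t,\xi)\,d\xi$$ is the broad solution of $(0,G^2,F^2,Q^1)$ with initial data $\gamma^0(x)=z^0(x)-\int_0^1H(t^0,x,\xi)z^0(\xi)\,d\xi$ at time $t^0$. -/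

import Mathlib

open Set Filter Topology MeasureTheory

noncomputable section

/-- Indices of the components of a vector of `ℝⁿ`, `n = m + p`: the `m` components with negative
speed come first (`Sum.inl`), followed by the `p` components with positive speed (`Sum.inr`). -/
abbrev StateIdx (m p : ℕ) : Type := Fin m ⊕ Fin p

/-- The standing assumptions on `Λ = diag(λ₁, …, λₙ)`, where `Λ i t x` is `λᵢ(t,x)` and `Λ` is
already extended to `ℝ²` with its properties preserved:
`C¹` regularity, boundedness of `Λ` and `∂Λ/∂x`, and
`λ₁ < ⋯ < λ_m < -ε < 0 < ε < λ_{m+1} < ⋯ < λ_n` with gaps larger than `ε`. (The gap between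
`λ_m` and `λ_{m+1}` is larger than `2ε` by the sign conditions.) -/
structure AdmissibleSpeeds {m p : ℕ} (Λ : StateIdx m p → ℝ → ℝ → ℝ) : Prop where
  contDiff : ∀ i, ContDiff ℝ 1 (fun q : ℝ × ℝ => Λ i q.1 q.2)
  bounded : ∃ C : ℝ, ∀ i t x, |Λ i t x| ≤ C
  bounded_deriv : ∃ C : ℝ, ∀ i t x, |deriv (Λ i t) x| ≤ C
  speeds : ∃ ε : ℝ, 0 < ε ∧ ∀ t x,
    (∀ i : Fin m, Λ (Sum.inl i) t x < -ε) ∧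
    (∀ i : Fin p, ε < Λ (Sum.inr i) t x) ∧
    (∀ i j : Fin m, i < j → ε < Λ (Sum.inl j) t x - Λ (Sum.inl i) t x) ∧
    (∀ i j : Fin p, i < j → ε < Λ (Sum.inr j) t x - Λ (Sum.inr i) t x)

/-- The flow of a scalar speed `l`: `flow l t x s` is `χ(s;t,x)`, the solution of
`∂χ/∂s = l(s, χ)` for all `s ∈ ℝ`, with `χ(t;t,x) = x`. -/
def flow (l : ℝ → ℝ → ℝ) (t x : ℝ) : ℝ → ℝ :=
  Classical.epsilon fun φ : ℝ → ℝ => φ t = x ∧ ∀ s, HasDerivAt φ (l s (φ s)) s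

/-- The characteristic `χᵢ(s;t,x)`; the arguments are in the order `i s t x`. -/
def chi {m p : ℕ} (Λ : StateIdx m p → ℝ → ℝ → ℝ) (i : StateIdx m p) (s t x : ℝ) : ℝ :=
  flow (Λ i) t x s

/-- The boundary point through which the `i`-th characteristics enter `[0,1]`. -/
def inletPt {m p : ℕ} : StateIdx m p → ℝ
  | Sum.inl _ => 1
  | Sum.inr _ => 0

/-- The boundary point through which the `i`-th characteristics leave `[0,1]`. -/
def outletPt {m p : ℕ} : StateIdx m p → ℝ
  | Sum.inl _ => 0
  | Sum.inr _ => 1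

/-- The entry time of the characteristic `χᵢ(·;t,x)` in `[0,1]`. -/
def entryTime {m p : ℕ} (Λ : StateIdx m p → ℝ → ℝ → ℝ) (i : StateIdx m p) (t x : ℝ) : ℝ :=
  Classical.epsilon fun s : ℝ => chi Λ i s t x = inletPt i

/-- The exit time of the characteristic `χᵢ(·;t,x)` from `[0,1]`. -/
def exitTime {m p : ℕ} (Λ : StateIdx m p → ℝ → ℝ → ℝ) (i : StateIdx m p) (t x : ℝ) : ℝ :=
  Classical.epsilon fun s : ℝ => chi Λ i s t x = outletPt i

/-- `max {t⁰, entry time}`. -/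
def entryTimeFrom {m p : ℕ} (Λ : StateIdx m p → ℝ → ℝ → ℝ) (t0 : ℝ) (i : StateIdx m p)
    (t x : ℝ) : ℝ :=
  max t0 (entryTime Λ i t x)

/-- A real function in `C⁰([0,+∞) × [0,1]) ∩ L^∞((0,+∞) × (0,1))`. -/
def ContBddStrip (g : ℝ → ℝ → ℝ) : Prop :=
  ContinuousOn (fun q : ℝ × ℝ => g q.1 q.2) (Ici 0 ×ˢ Icc 0 1) ∧
    ∃ C : ℝ, ∀ t ∈ Ici (0 : ℝ), ∀ x ∈ Icc (0 : ℝ) 1, |g t x| ≤ C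

/-- A real function in `C⁰([0,+∞)) ∩ L^∞(0,+∞)`. -/
def ContBddHalfLine (q : ℝ → ℝ) : Prop :=
  ContinuousOn q (Ici 0) ∧ ∃ C : ℝ, ∀ t ∈ Ici (0 : ℝ), |q t| ≤ C

/-- A real function in `L^∞((0,+∞) × (0,1))`. -/
def EssBddStrip (f : ℝ → ℝ → ℝ) : Prop :=
  MemLp (fun q : ℝ × ℝ => f q.1 q.2) ⊤ (volume.restrict (Ioi 0 ×ˢ Ioo 0 1))

/-- `f(t,·)` belongs to `L²(A)` for every `t ∈ S`, and `t ↦ f(t,·)` is continuous from `S` to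
`L²(A)`. -/
def ContL2 (S A : Set ℝ) (f : ℝ → ℝ → ℝ) : Prop :=
  (∀ t ∈ S, MemLp (f t) 2 (volume.restrict A)) ∧
    ∀ t ∈ S, Tendsto (fun s => eLpNorm (fun x => f s x - f t x) 2 (volume.restrict A))
      (𝓝[S] t) (𝓝 0)

/-- `y ∈ C⁰([t⁰,t⁰+T]; L²(0,1)ⁿ) ∩ C⁰([0,1]; L²(t⁰,t⁰+T)ⁿ)` for all `T > 0`.
The function `y` is a representative whose slices `y(t,·)`, `t ≥ t⁰`, and `y(·,x)`, `x ∈ [0,1]`,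
are the values of the two continuous maps; such a representative exists for every element of the
intersection, and it gives `y(·,0)` its meaning. Joint measurability ensures that the two
continuous maps come from the same element of `L²`. -/
structure BroadRegularity {m p : ℕ} (t0 : ℝ) (y : ℝ → ℝ → StateIdx m p → ℝ) : Prop where
  measurable : ∀ i, AEStronglyMeasurable (fun q : ℝ × ℝ => y q.1 q.2 i)
    (volume.restrict (Ioi t0 ×ˢ Ioo 0 1))
  cont_time : ∀ i, ∀ T > 0, ContL2 (Icc t0 (t0 + T)) (Ioo 0 1) (fun t x => y t x i)
  cont_space : ∀ i, ∀ T > 0, ContL2 (Icc 0 1) (Ioo t0 (t0 + T)) (fun x t => y t x i)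

/-- The boundary or initial value `bᵢ(y)(t,x)` carried by the characteristic `χᵢ(·;t,x)`. -/
def inflowValue {m p : ℕ} (Λ : StateIdx m p → ℝ → ℝ → ℝ)
    (F : ℝ → ℝ → Matrix (Fin m) (StateIdx m p) ℝ) (Q : ℝ → Matrix (Fin p) (Fin m) ℝ)
    (t0 : ℝ) (y0 : ℝ → StateIdx m p → ℝ) (y : ℝ → ℝ → StateIdx m p → ℝ)
    (i : StateIdx m p) (t x : ℝ) : ℝ :=
  if t0 < entryTime Λ i t x then
    match i with
    | Sum.inl k => ∑ j : StateIdx m p, ∫ ξ in (0 : ℝ)..1,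
        F (entryTime Λ i t x) ξ k j * y (entryTime Λ i t x) ξ j
    | Sum.inr k => ∑ j : Fin m, Q (entryTime Λ i t x) k j * y (entryTime Λ i t x) 0 (Sum.inl j)
  else y0 (chi Λ i t0 t x) i

/-- `y` is a broad solution (solution along the characteristics) of the system `(M,G,F,Q)`
`∂y/∂t + Λ ∂y/∂x = M y + G y(t,0)`, `y₋(t,1) = ∫₀¹ F(t,ξ) y(t,ξ) dξ`, `y₊(t,0) = Q(t) y₋(t,0)`,
`y(t⁰,x) = y⁰(x)`. -/
structure IsBroadSolution {m p : ℕ} (Λ : StateIdx m p → ℝ → ℝ → ℝ)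
    (M G : ℝ → ℝ → Matrix (StateIdx m p) (StateIdx m p) ℝ)
    (F : ℝ → ℝ → Matrix (Fin m) (StateIdx m p) ℝ) (Q : ℝ → Matrix (Fin p) (Fin m) ℝ)
    (t0 : ℝ) (y0 : ℝ → StateIdx m p → ℝ) (y : ℝ → ℝ → StateIdx m p → ℝ) : Prop where
  initial_memLp : ∀ i, MemLp (fun x => y0 x i) 2 (volume.restrict (Ioo 0 1))
  regularity : BroadRegularity t0 y
  equation : ∀ i, ∀ᵐ q : ℝ × ℝ ∂(volume.restrict (Ioi t0 ×ˢ Ioo 0 1)),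
    y q.1 q.2 i = inflowValue Λ F Q t0 y0 y i q.1 q.2
      + ∑ j, (∫ s in (entryTimeFrom Λ t0 i q.1 q.2)..q.1,
          M s (chi Λ i s q.1 q.2) i j * y s (chi Λ i s q.1 q.2) j)
      + ∑ j, (∫ s in (entryTimeFrom Λ t0 i q.1 q.2)..q.1,
          G s (chi Λ i s q.1 q.2) i j * y s 0 j)

/-- The entry time of the characteristic `s ↦ (s, χᵢ(s;t,x), χⱼ(s;t,ξ))`, `i, j ≤ m`, in
`(0,+∞) × (0,1) × (0,1)`. -/
def entryTime₂ {m p : ℕ} (Λ : StateIdx m p → ℝ → ℝ → ℝ) (i j : Fin m) (t x ξ : ℝ) : ℝ :=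
  max 0 (max (entryTime Λ (Sum.inl i) t x) (entryTime Λ (Sum.inl j) t ξ))

/-- The exit time of the characteristic `s ↦ (s, χᵢ(s;t,x), χⱼ(s;t,ξ))`, `i, j ≤ m`, from
`(0,+∞) × (0,1) × (0,1)`. -/
def exitTime₂ {m p : ℕ} (Λ : StateIdx m p → ℝ → ℝ → ℝ) (i j : Fin m) (t x ξ : ℝ) : ℝ :=
  min (exitTime Λ (Sum.inl i) t x) (exitTime Λ (Sum.inl j) t ξ)

/-- The value `b_{ij}(t,x,ξ)` of the kernel at the exit point of the characteristic through
`(t,x,ξ)`: zero if it leaves through `x = 0` first, `-g_{ij}/λⱼ` at the exit point if it leaves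
through `ξ = 0` first. -/
def kernelExitValue {m p : ℕ} (Λ : StateIdx m p → ℝ → ℝ → ℝ)
    (g : ℝ → ℝ → Matrix (Fin m) (Fin m) ℝ) (i j : Fin m) (t x ξ : ℝ) : ℝ :=
  if exitTime Λ (Sum.inl i) t x < exitTime Λ (Sum.inl j) t ξ then 0
  else -(g (exitTime Λ (Sum.inl j) t ξ)
        (chi Λ (Sum.inl i) (exitTime Λ (Sum.inl j) t ξ) t x) i j
      / Λ (Sum.inl j) (exitTime Λ (Sum.inl j) t ξ) 0)

/-- `h = (h_{ij})_{1 ≤ i,j ≤ m}` solves, along the characteristics, the kernel equations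
`∂h_{ij}/∂t + λᵢ(t,x) ∂h_{ij}/∂x + λⱼ(t,ξ) ∂h_{ij}/∂ξ + ∂λⱼ/∂ξ(t,ξ) h_{ij} = 0`,
`h_{ij}(t,0,ξ) = 0`, `h_{ij}(t,x,0) = -g_{ij}(t,x)/λⱼ(t,0)`.
Nothing is required on the characteristics that leave the domain through the edge `x = ξ = 0`:
the kernel is discontinuous there. -/
structure IsKernelSolution {m p : ℕ} (Λ : StateIdx m p → ℝ → ℝ → ℝ)
    (g : ℝ → ℝ → Matrix (Fin m) (Fin m) ℝ)
    (h : ℝ → ℝ → ℝ → Matrix (Fin m) (Fin m) ℝ) : Prop where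
  ode : ∀ (i j : Fin m), ∀ t > 0, ∀ x ∈ Ioo (0 : ℝ) 1, ∀ ξ ∈ Ioo (0 : ℝ) 1,
    exitTime Λ (Sum.inl i) t x ≠ exitTime Λ (Sum.inl j) t ξ →
    ∀ s ∈ Icc (entryTime₂ Λ i j t x ξ) (exitTime₂ Λ i j t x ξ),
      HasDerivWithinAt
        (fun σ => h σ (chi Λ (Sum.inl i) σ t x) (chi Λ (Sum.inl j) σ t ξ) i j)
        (-(deriv (Λ (Sum.inl j) s) (chi Λ (Sum.inl j) s t ξ))
          * h s (chi Λ (Sum.inl i) s t x) (chi Λ (Sum.inl j) s t ξ) i j)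
        (Icc (entryTime₂ Λ i j t x ξ) (exitTime₂ Λ i j t x ξ)) s
  exit_value : ∀ (i j : Fin m), ∀ t > 0, ∀ x ∈ Ioo (0 : ℝ) 1, ∀ ξ ∈ Ioo (0 : ℝ) 1,
    exitTime Λ (Sum.inl i) t x ≠ exitTime Λ (Sum.inl j) t ξ →
    h (exitTime₂ Λ i j t x ξ)
        (chi Λ (Sum.inl i) (exitTime₂ Λ i j t x ξ) t x)
        (chi Λ (Sum.inl j) (exitTime₂ Λ i j t x ξ) t ξ) i j
      = kernelExitValue Λ g i j t x ξ

/-- The full kernel `H`, whose only nonzero block is `H₋₋`. -/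
def fullKernel {m p : ℕ} (h : ℝ → ℝ → ℝ → Matrix (Fin m) (Fin m) ℝ) (t x ξ : ℝ) :
    Matrix (StateIdx m p) (StateIdx m p) ℝ :=
  Matrix.fromBlocks (h t x ξ) 0 0 0

/-- The Fredholm operator at a fixed time: `v(x) - ∫₀¹ K(x,ξ) v(ξ) dξ`. -/
def fredholmSlice {m p : ℕ} (K : ℝ → ℝ → Matrix (StateIdx m p) (StateIdx m p) ℝ)
    (v : ℝ → StateIdx m p → ℝ) (x : ℝ) : StateIdx m p → ℝ :=
  fun i => v x i - ∫ ξ in (0 : ℝ)..1, (Matrix.mulVec (K x ξ) (v ξ)) i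

/-- The Fredholm transformation `γ(t,x) = z(t,x) - ∫₀¹ H(t,x,ξ) z(t,ξ) dξ`. -/
def fredholmTransform {m p : ℕ} (H : ℝ → ℝ → ℝ → Matrix (StateIdx m p) (StateIdx m p) ℝ)
    (z : ℝ → ℝ → StateIdx m p → ℝ) (t x : ℝ) : StateIdx m p → ℝ :=
  fredholmSlice (H t) (z t) x

/-- `F ∈ L^∞((0,+∞) × (0,1))^{m × n}` solves the Fredholm equation
`F(t,ξ) - ∫₀¹ F(t,ζ) H(t,ζ,ξ) dζ = -H₋(t,1,ξ)`, where `H₋` consists of the first `m` rows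
of `H`. -/
structure IsGainSolution {m p : ℕ} (H : ℝ → ℝ → ℝ → Matrix (StateIdx m p) (StateIdx m p) ℝ)
    (F : ℝ → ℝ → Matrix (Fin m) (StateIdx m p) ℝ) : Prop where
  bounded : ∀ i j, EssBddStrip (fun t ξ => F t ξ i j)
  equation : ∀ᵐ q : ℝ × ℝ ∂(volume.restrict (Ioi 0 ×ˢ Ioo 0 1)), ∀ i j,
    F q.1 q.2 i j - (∫ ζ in (0 : ℝ)..1, (F q.1 ζ * H q.1 ζ q.2) i j)
      = -(H q.1 1 q.2 (Sum.inl i) j)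

/-- `G² = (G²₋₋ 0; G²₊₋ 0)`. -/
def sourceMatrix {m p : ℕ} (Gmm : ℝ → ℝ → Matrix (Fin m) (Fin m) ℝ)
    (Gpm : ℝ → ℝ → Matrix (Fin p) (Fin m) ℝ) (t x : ℝ) :
    Matrix (StateIdx m p) (StateIdx m p) ℝ :=
  Matrix.fromBlocks (Gmm t x) 0 (Gpm t x) 0

/-- `G³ = (0 0; G²₊₋ 0)`. -/
def targetMatrix {m p : ℕ} (Gpm : ℝ → ℝ → Matrix (Fin p) (Fin m) ℝ) (t x : ℝ) :
    Matrix (StateIdx m p) (StateIdx m p) ℝ :=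
  Matrix.fromBlocks 0 0 (Gpm t x) 0

end

noncomputable section

/-! The negative components of `z` have neither source nor inflow, so `z_j(t,x) = f_j(χ_j(t0;t,x))`,
where `f_j` is the initial datum extended by zero outside `(0,1]`. L² continuity carries this from
almost every slice to every time `t ≥ t0`, and to the trace at `x = 0`, which is `u_j(s) =
f_j(χ_j(t0;s,0))` for almost every `s`.

Substitute `ξ = χ_j(t;s,0)` in `∫ h_ij(t,x,ξ) z_j(t,ξ) dξ`. The Jacobian cancels both the
exponential and the factor `1/λ_j` in the explicit kernel, and the jump of `h_ij` becomes an
endpoint of integration. There remains the integral of `g_ij(s,χ_i(s;t,x)) u_j(s)` for `s` from `t`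
to the exit time of `χ_i` (`IsKernelSolution.integral_mul_transported`). Its sum `W_i` over `j` is
continuous in `(t,x)`, which gives the regularity of `γ_i = z_i - W_i`; and `W_i` decreases along
`χ_i` at the rate `∑ g_ij u_j`, which produces the source (`NegativeSpeed.outflowIntegral_flow`).

The kernel vanishes at `x = 0`, so `γ` and `z` have the same trace there and the positive equations
do not change. At `x = 1` the inflow of `z_i` is zero, so that of `γ_i` is `-W_i`; the gain equation
integrated against `z`, with Fubini, identifies it with `∫ F γ`
(`IsGainSolution.ae_sum_integral_eq`). -/

/-! ### Global flow of a scalar speed -/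

/-- A `C¹` speed, bounded by `C`, whose space derivative is bounded by `K`. -/
structure RegularSpeed (l : ℝ → ℝ → ℝ) (C K : ℝ) : Prop where
  contDiff : ContDiff ℝ 1 (fun q : ℝ × ℝ => l q.1 q.2)
  bound : ∀ t x, |l t x| ≤ C
  deriv_bound : ∀ t x, |deriv (l t) x| ≤ K

/-- The averaged space derivative of `l` between two states. -/
def meanDeriv (l : ℝ → ℝ → ℝ) (s y y' : ℝ) : ℝ :=
  ∫ θ in (0 : ℝ)..1, deriv (l s) (y' + θ * (y - y'))

namespace RegularSpeed

variable {l : ℝ → ℝ → ℝ} {C K : ℝ}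

lemma C_nonneg (hl : RegularSpeed l C K) : 0 ≤ C := (abs_nonneg _).trans (hl.bound 0 0)

lemma K_nonneg (hl : RegularSpeed l C K) : 0 ≤ K := (abs_nonneg _).trans (hl.deriv_bound 0 0)

lemma continuous (hl : RegularSpeed l C K) : Continuous fun q : ℝ × ℝ => l q.1 q.2 :=
  hl.contDiff.continuous

lemma hasDerivAt (hl : RegularSpeed l C K) (s x : ℝ) :
    HasDerivAt (l s) (fderiv ℝ (fun q : ℝ × ℝ => l q.1 q.2) (s, x) (0, 1)) x := by
  have h1 : HasFDerivAt (fun q : ℝ × ℝ => l q.1 q.2)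
      (fderiv ℝ (fun q : ℝ × ℝ => l q.1 q.2) (s, x)) (s, x) :=
    (hl.contDiff.differentiable (by norm_num)).differentiableAt.hasFDerivAt
  have h2 : HasDerivAt (fun y : ℝ => (s, y)) (0, 1) x :=
    (hasDerivAt_const x s).prodMk (hasDerivAt_id x)
  exact h1.comp_hasDerivAt x h2

lemma continuous_deriv (hl : RegularSpeed l C K) :
    Continuous fun q : ℝ × ℝ => deriv (l q.1) q.2 := by
  have h : (fun q : ℝ × ℝ => deriv (l q.1) q.2)
      = fun q => fderiv ℝ (fun q : ℝ × ℝ => l q.1 q.2) q (0, 1) := by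
    funext q
    exact (hl.hasDerivAt q.1 q.2).deriv
  rw [h]
  exact (hl.contDiff.continuous_fderiv (by norm_num)).clm_apply continuous_const

lemma differentiable (hl : RegularSpeed l C K) (s : ℝ) : Differentiable ℝ (l s) :=
  fun x => (hl.hasDerivAt s x).differentiableAt

lemma lipschitzWith (hl : RegularSpeed l C K) (s : ℝ) :
    LipschitzWith (Real.toNNReal K) (l s) :=
  lipschitzWith_of_nnnorm_deriv_le (hl.differentiable s) fun x => by
    rw [← NNReal.coe_le_coe, coe_nnnorm, Real.coe_toNNReal _ hl.K_nonneg]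
    exact hl.deriv_bound s x

lemma continuous_meanDeriv (hl : RegularSpeed l C K) :
    Continuous fun q : ℝ × ℝ × ℝ => meanDeriv l q.1 q.2.1 q.2.2 := by
  unfold meanDeriv
  apply intervalIntegral.continuous_parametric_intervalIntegral_of_continuous'
  have := hl.continuous_deriv
  exact this.comp (f := fun p : (ℝ × ℝ × ℝ) × ℝ =>
    (p.1.1, p.1.2.2 + p.2 * (p.1.2.1 - p.1.2.2))) (by fun_prop)

lemma abs_meanDeriv_le (hl : RegularSpeed l C K) (s y y' : ℝ) : |meanDeriv l s y y'| ≤ K := by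
  have := intervalIntegral.norm_integral_le_of_norm_le_const (a := 0) (b := 1) (C := K)
    (f := fun θ => deriv (l s) (y' + θ * (y - y'))) (fun θ _ => hl.deriv_bound _ _)
  simpa [meanDeriv] using this

lemma meanDeriv_self (s y : ℝ) : meanDeriv l s y y = deriv (l s) y := by
  simp [meanDeriv]

/-- The averaged derivative replaces an intermediate point of the mean value theorem because it
depends continuously on both states and can be integrated in time. -/
lemma sub_eq_meanDeriv_mul (hl : RegularSpeed l C K) (s y y' : ℝ) :
    l s y - l s y' = meanDeriv l s y y' * (y - y') := by
  have hd : ∀ θ ∈ uIcc (0 : ℝ) 1, HasDerivAt (fun θ => l s (y' + θ * (y - y')))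
      (deriv (l s) (y' + θ * (y - y')) * (y - y')) θ := by
    intro θ _
    have h1 : HasDerivAt (fun θ : ℝ => y' + θ * (y - y')) (y - y') θ := by
      simpa using ((hasDerivAt_id θ).mul_const (y - y')).const_add y'
    exact ((hl.differentiable s) _).hasDerivAt.comp θ h1
  have hc : Continuous fun θ : ℝ => deriv (l s) (y' + θ * (y - y')) * (y - y') := by
    have := hl.continuous_deriv.comp (f := fun θ : ℝ => (s, y' + θ * (y - y'))) (by fun_prop)
    exact this.mul continuous_const
  have := intervalIntegral.integral_eq_sub_of_hasDerivAt hd (hc.intervalIntegrable _ _)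
  rw [intervalIntegral.integral_mul_const] at this
  simp only [one_mul, zero_mul, add_zero, add_sub_cancel] at this
  exact this.symm

/-- The difference of two solutions solves a scalar linear equation. -/
lemma sub_eq_mul_exp (hl : RegularSpeed l C K) {φ ψ : ℝ → ℝ}
    (hφ : ∀ s, HasDerivAt φ (l s (φ s)) s) (hψ : ∀ s, HasDerivAt ψ (l s (ψ s)) s) (t s : ℝ) :
    φ s - ψ s = (φ t - ψ t) * Real.exp (∫ r in t..s, meanDeriv l r (φ r) (ψ r)) := by
  have hφc : Continuous φ := continuous_iff_continuousAt.2 fun s => (hφ s).continuousAt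
  have hψc : Continuous ψ := continuous_iff_continuousAt.2 fun s => (hψ s).continuousAt
  have hA : Continuous fun r => meanDeriv l r (φ r) (ψ r) :=
    hl.continuous_meanDeriv.comp (f := fun r => (r, φ r, ψ r)) (by fun_prop)
  have hI : ∀ s, HasDerivAt (fun s => ∫ r in t..s, meanDeriv l r (φ r) (ψ r))
      (meanDeriv l s (φ s) (ψ s)) s := fun s => hA.integral_hasStrictDerivAt t s |>.hasDerivAt
  set E := fun s => (φ s - ψ s) * Real.exp (-∫ r in t..s, meanDeriv l r (φ r) (ψ r)) with hE
  have hE' : ∀ s, HasDerivAt E 0 s := by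
    intro s
    refine (((hφ s).fun_sub (hψ s)).fun_mul ((hI s).fun_neg.exp)).congr_deriv ?_
    rw [hl.sub_eq_meanDeriv_mul]
    ring
  have hconst := is_const_of_deriv_eq_zero (fun s => (hE' s).differentiableAt)
    (fun s => (hE' s).deriv) s t
  simp only [hE, intervalIntegral.integral_same, neg_zero, Real.exp_zero, mul_one] at hconst
  rw [← hconst, mul_assoc, ← Real.exp_add]
  simp

/-- Picard–Lindelöf applies on every window `[t-(n+1), t+(n+1)]`: a speed bounded by `C` cannot
leave the ball of radius `C(n+1)`. Uniqueness makes the local solutions compatible. -/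
lemma exists_solution (hl : RegularSpeed l C K) (t x : ℝ) :
    ∃ φ : ℝ → ℝ, φ t = x ∧ ∀ s, HasDerivAt φ (l s (φ s)) s := by
  have hloc : ∀ n : ℕ, ∃ φ : ℝ → ℝ, φ t = x ∧
      ∀ s ∈ Ioo (t - (n + 1)) (t + (n + 1)), HasDerivAt φ (l s (φ s)) s := by
    intro n
    have hn : (0 : ℝ) < n + 1 := by positivity
    have ht : t ∈ Icc (t - (n + 1)) (t + (n + 1)) := by constructor <;> linarith
    have hC := hl.C_nonneg
    have hpl : IsPicardLindelof l (⟨t, ht⟩ : Icc (t - ((n : ℝ) + 1)) (t + (n + 1))) x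
        (Real.toNNReal (C * (n + 1))) 0 (Real.toNNReal C) (Real.toNNReal K) :=
      { lipschitzOnWith := fun s _ => (hl.lipschitzWith s).lipschitzOnWith
        continuousOn := fun y _ => (hl.continuous.comp
          (f := fun s : ℝ => (s, y)) (by fun_prop)).continuousOn
        norm_le := fun s _ y _ => by
          rw [Real.coe_toNNReal _ hC]; exact hl.bound s y
        mul_max_le := by
          rw [Real.coe_toNNReal _ hC, Real.coe_toNNReal _ (by positivity)]
          simp }
    obtain ⟨φ, h0, h1⟩ := hpl.exists_eq_forall_mem_Icc_hasDerivWithinAt₀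
    exact ⟨φ, h0, fun s hs => (h1 s (Ioo_subset_Icc_self hs)).hasDerivAt (Icc_mem_nhds hs.1 hs.2)⟩
  choose φ h0 h1 using hloc
  have huniq : ∀ n N : ℕ, n ≤ N → EqOn (φ n) (φ N) (Ioo (t - (n + 1)) (t + (n + 1))) := by
    intro n N hnN
    have hn : (0 : ℝ) < n + 1 := by positivity
    have hnN' : (n : ℝ) ≤ N := by exact_mod_cast hnN
    refine ODE_solution_unique_of_mem_Ioo (v := l) (s := fun _ => univ) (t₀ := t)
      (fun s _ => (hl.lipschitzWith s).lipschitzOnWith) ⟨by linarith, by linarith⟩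
      (fun s hs => ⟨h1 n s hs, mem_univ _⟩) (fun s hs => ⟨h1 N s ⟨?_, ?_⟩, mem_univ _⟩)
      ((h0 n).trans (h0 N).symm)
    · linarith [hs.1]
    · linarith [hs.2]
  have hmem : ∀ s : ℝ, s ∈ Ioo (t - ((⌈|s - t|⌉₊ : ℕ) + 1 : ℝ)) (t + ((⌈|s - t|⌉₊ : ℕ) + 1)) := by
    intro s
    have := Nat.le_ceil |s - t|
    have h3 := abs_le.1 this
    constructor <;> linarith
  -- The extra `1` in the window puts `s` in its interior, so near `s` the glued function is a
  -- single local solution.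
  refine ⟨fun s => φ ⌈|s - t|⌉₊ s, h0 _, fun s => ?_⟩
  set N := ⌈|s - t|⌉₊ with hN
  have hev : (fun r => φ ⌈|r - t|⌉₊ r) =ᶠ[𝓝 s] φ N := by
    filter_upwards [Ioo_mem_nhds (hmem s).1 (hmem s).2] with r hr
    rcases le_total ⌈|r - t|⌉₊ N with h | h
    · exact huniq _ _ h (hmem r)
    · exact (huniq _ _ h hr).symm
  exact (h1 N s (hmem s)).congr_of_eventuallyEq hev

lemma flow_spec (hl : RegularSpeed l C K) (t x : ℝ) :
    flow l t x t = x ∧ ∀ s, HasDerivAt (flow l t x) (l s (flow l t x s)) s :=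
  Classical.epsilon_spec (hl.exists_solution t x)

lemma flow_self (hl : RegularSpeed l C K) (t x : ℝ) : flow l t x t = x := (hl.flow_spec t x).1

lemma hasDerivAt_flow (hl : RegularSpeed l C K) (t x s : ℝ) :
    HasDerivAt (flow l t x) (l s (flow l t x s)) s := (hl.flow_spec t x).2 s

lemma flow_unique (hl : RegularSpeed l C K) {φ : ℝ → ℝ} {t x : ℝ} (h0 : φ t = x)
    (hφ : ∀ s, HasDerivAt φ (l s (φ s)) s) : φ = flow l t x := by
  funext s
  have := hl.sub_eq_mul_exp hφ (hl.hasDerivAt_flow t x) t s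
  rw [h0, hl.flow_self, sub_self, zero_mul] at this
  linarith

lemma flow_flow (hl : RegularSpeed l C K) (t x r s : ℝ) :
    flow l r (flow l t x r) s = flow l t x s :=
  congrFun (hl.flow_unique rfl (hl.hasDerivAt_flow t x)).symm s

lemma flow_sub_flow (hl : RegularSpeed l C K) (t x t' x' r s : ℝ) :
    flow l t x s - flow l t' x' s = (flow l t x r - flow l t' x' r)
      * Real.exp (∫ ρ in r..s, meanDeriv l ρ (flow l t x ρ) (flow l t' x' ρ)) :=
  hl.sub_eq_mul_exp (hl.hasDerivAt_flow t x) (hl.hasDerivAt_flow t' x') r s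

lemma abs_integral_meanDeriv_le (hl : RegularSpeed l C K) (φ ψ : ℝ → ℝ) (r s : ℝ) :
    |∫ ρ in r..s, meanDeriv l ρ (φ ρ) (ψ ρ)| ≤ K * |s - r| :=
  intervalIntegral.norm_integral_le_of_norm_le_const
    (f := fun ρ => meanDeriv l ρ (φ ρ) (ψ ρ)) fun _ _ => hl.abs_meanDeriv_le _ _ _

lemma abs_flow_sub_flow_le (hl : RegularSpeed l C K) (t x t' x' r s : ℝ) :
    |flow l t x s - flow l t' x' s| ≤
      |flow l t x r - flow l t' x' r| * Real.exp (K * |s - r|) := by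
  rw [hl.flow_sub_flow t x t' x' r s, abs_mul, Real.abs_exp]
  gcongr
  exact (le_abs_self _).trans (hl.abs_integral_meanDeriv_le _ _ _ _)

/-- Trajectories never cross: their difference keeps its sign, being multiplied by an exponential.
-/
lemma flow_lt_flow_iff (hl : RegularSpeed l C K) (t x t' x' r s : ℝ) :
    flow l t x s < flow l t' x' s ↔ flow l t x r < flow l t' x' r := by
  rw [← sub_neg, hl.flow_sub_flow t x t' x' r s, ← zero_mul (Real.exp _),
    mul_lt_mul_iff_left₀ (Real.exp_pos _), sub_neg]

lemma continuous_flow_time (hl : RegularSpeed l C K) (t x : ℝ) : Continuous (flow l t x) :=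
  continuous_iff_continuousAt.2 fun s => (hl.hasDerivAt_flow t x s).continuousAt

lemma abs_flow_sub_le (hl : RegularSpeed l C K) (t x s s' : ℝ) :
    |flow l t x s - flow l t x s'| ≤ C * |s - s'| := by
  have h := lipschitzWith_of_nnnorm_deriv_le (C := Real.toNNReal C) (f := flow l t x)
    (fun s => (hl.hasDerivAt_flow t x s).differentiableAt) fun s => by
      rw [← NNReal.coe_le_coe, coe_nnnorm, Real.coe_toNNReal _ hl.C_nonneg,
        (hl.hasDerivAt_flow t x s).deriv]
      exact hl.bound _ _
  have := h.dist_le_mul s s'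
  rwa [Real.coe_toNNReal _ hl.C_nonneg, Real.dist_eq, Real.dist_eq] at this

lemma continuous_flow (hl : RegularSpeed l C K) :
    Continuous fun q : ℝ × ℝ × ℝ => flow l q.1 q.2.1 q.2.2 := by
  rw [continuous_iff_continuousAt]
  rintro ⟨t, x, s⟩
  rw [ContinuousAt, tendsto_iff_dist_tendsto_zero]
  -- The trajectories are compared at the common time `t`, the error is propagated to `q.2.2` by
  -- Gronwall, and the final time is then moved to `s`.
  have hb : ∀ q : ℝ × ℝ × ℝ, dist (flow l q.1 q.2.1 q.2.2) (flow l t x s) ≤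
      (C * |t - q.1| + |q.2.1 - x|) * Real.exp (K * |q.2.2 - t|) + C * |q.2.2 - s| := by
    rintro ⟨t', x', s'⟩
    have h1 := hl.abs_flow_sub_flow_le t' x' t x t s'
    have h2 := hl.abs_flow_sub_le t' x' t t'
    have h3 := hl.abs_flow_sub_le t x s' s
    rw [hl.flow_self] at h2
    rw [hl.flow_self t x] at h1
    have h4 : |flow l t' x' t - x| ≤ C * |t - t'| + |x' - x| := by
      calc _ = |(flow l t' x' t - x') + (x' - x)| := by ring_nf
        _ ≤ _ := (abs_add_le _ _).trans (by gcongr)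
    calc |flow l t' x' s' - flow l t x s|
        = |(flow l t' x' s' - flow l t x s') + (flow l t x s' - flow l t x s)| := by ring_nf
      _ ≤ _ := (abs_add_le _ _).trans (by
        refine add_le_add (h1.trans ?_) h3
        gcongr)
  refine squeeze_zero (fun _ => dist_nonneg) hb ?_
  have : Continuous fun q : ℝ × ℝ × ℝ =>
      (C * |t - q.1| + |q.2.1 - x|) * Real.exp (K * |q.2.2 - t|) + C * |q.2.2 - s| := by fun_prop
  simpa using this.tendsto (t, x, s)

/-- The derivative of the flow with respect to the initial time. -/
lemma hasDerivAt_flow_initialTime (hl : RegularSpeed l C K) (t y s : ℝ) :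
    HasDerivAt (fun s => flow l s y t)
      (-(l s y) * Real.exp (∫ r in s..t, deriv (l r) (flow l s y r))) s := by
  have hfl := hl.continuous_flow
  -- displacement at time `s` of the trajectory starting at time `s'`
  set B : ℝ → ℝ := fun s' =>
    -∫ θ in (0 : ℝ)..1, l (s + θ * (s' - s)) (flow l s' y (s + θ * (s' - s))) with hB
  have hBc : Continuous B := by
    refine (intervalIntegral.continuous_parametric_intervalIntegral_of_continuous' ?_ _ _).neg
    refine hl.continuous.comp (f := fun p : ℝ × ℝ =>
      (s + p.2 * (p.1 - s), flow l p.1 y (s + p.2 * (p.1 - s)))) ?_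
    refine Continuous.prodMk (by fun_prop) ?_
    exact hfl.comp (f := fun p : ℝ × ℝ => (p.1, y, s + p.2 * (p.1 - s))) (by fun_prop)
  have hBeq : ∀ s', flow l s' y s - y = (s' - s) * B s' := by
    intro s'
    have hd : ∀ θ ∈ uIcc (0 : ℝ) 1, HasDerivAt (fun θ => flow l s' y (s + θ * (s' - s)))
        (l (s + θ * (s' - s)) (flow l s' y (s + θ * (s' - s))) * (s' - s)) θ := by
      intro θ _
      have h1 : HasDerivAt (fun θ : ℝ => s + θ * (s' - s)) (s' - s) θ := by
        simpa using ((hasDerivAt_id θ).mul_const (s' - s)).const_add s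
      exact (hl.hasDerivAt_flow s' y _).comp θ h1
    have hc : Continuous fun θ : ℝ =>
        l (s + θ * (s' - s)) (flow l s' y (s + θ * (s' - s))) * (s' - s) := by
      refine (hl.continuous.comp (f := fun θ : ℝ =>
        (s + θ * (s' - s), flow l s' y (s + θ * (s' - s)))) ?_).mul continuous_const
      exact Continuous.prodMk (by fun_prop) ((hl.continuous_flow_time s' y).comp (by fun_prop))
    have := intervalIntegral.integral_eq_sub_of_hasDerivAt hd (hc.intervalIntegrable _ _)
    rw [intervalIntegral.integral_mul_const] at this
    simp only [one_mul, zero_mul, add_zero, add_sub_cancel, hl.flow_self] at this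
    simp only [hB]
    linarith
  -- `D` is the difference quotient with `s' - s` factored out explicitly. Its continuity gives the
  -- derivative without differentiating the flow in its initial state.
  set D : ℝ → ℝ := fun s' =>
    B s' * Real.exp (∫ r in s..t, meanDeriv l r (flow l s' y r) (flow l s y r)) with hD
  have hDc : Continuous D := by
    refine hBc.mul (Real.continuous_exp.comp ?_)
    refine intervalIntegral.continuous_parametric_intervalIntegral_of_continuous' ?_ _ _
    refine hl.continuous_meanDeriv.comp (f := fun p : ℝ × ℝ =>
      (p.2, flow l p.1 y p.2, flow l s y p.2)) ?_
    refine Continuous.prodMk (by fun_prop) (Continuous.prodMk ?_ ?_)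
    · exact hfl.comp (f := fun p : ℝ × ℝ => (p.1, y, p.2)) (by fun_prop)
    · exact (hl.continuous_flow_time s y).comp continuous_snd
  have hDeq : ∀ s', flow l s' y t - flow l s y t = (s' - s) * D s' := by
    intro s'
    rw [hl.flow_sub_flow s' y s y s t, hl.flow_self s y, hBeq, hD, mul_assoc]
  have hDs : D s = -(l s y) * Real.exp (∫ r in s..t, deriv (l r) (flow l s y r)) := by
    simp [hD, hB, meanDeriv_self, hl.flow_self]
  rw [← hDs, hasDerivAt_iff_tendsto_slope]
  refine ((hDc.tendsto s).mono_left nhdsWithin_le_nhds).congr' ?_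
  filter_upwards [self_mem_nhdsWithin] with s' hs'
  have : s' - s ≠ 0 := sub_ne_zero.2 hs'
  rw [slope_def_field, hDeq, mul_div_cancel_left₀ _ this]

end RegularSpeed

/-! ### Hitting times for negative speeds -/

/-- The time at which the trajectory through `(t,x)` reaches `y`. -/
def hitTime (l : ℝ → ℝ → ℝ) (y t x : ℝ) : ℝ :=
  Classical.epsilon fun s : ℝ => flow l t x s = y

/-- A regular speed bounded above by `-ε < 0`. -/
structure NegativeSpeed (l : ℝ → ℝ → ℝ) (C K ε : ℝ) : Prop extends RegularSpeed l C K where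
  pos : 0 < ε
  lt_neg : ∀ t x, l t x < -ε

namespace NegativeSpeed

variable {l : ℝ → ℝ → ℝ} {C K ε : ℝ}

/-- Trajectories descend at rate at least `ε`. This is the source of monotonicity, of the existence
of hitting times and of the lower bounds on distances. -/
lemma flow_add_le (hl : NegativeSpeed l C K ε) (t x : ℝ) {s s' : ℝ} (h : s ≤ s') :
    flow l t x s' + ε * (s' - s) ≤ flow l t x s := by
  have hd : ∀ s, HasDerivAt (fun s => flow l t x s + ε * s) (l s (flow l t x s) + ε) s := by
    intro s
    refine ((hl.hasDerivAt_flow t x s).fun_add ((hasDerivAt_id s).const_mul ε)).congr_deriv ?_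
    simp
  have ha := antitone_of_deriv_nonpos (fun s => (hd s).differentiableAt) fun s => by
    rw [(hd s).deriv]; linarith [hl.lt_neg s (flow l t x s)]
  have := ha h
  simp only at this
  linarith

lemma mul_abs_sub_le (hl : NegativeSpeed l C K ε) (t x s s' : ℝ) :
    ε * |s - s'| ≤ |flow l t x s - flow l t x s'| := by
  have hε := hl.pos
  rcases le_total s s' with h | h
  · have := hl.flow_add_le t x h
    rw [abs_of_nonpos (by linarith : s - s' ≤ 0)]
    exact le_trans (by linarith) (le_abs_self _)
  · have := hl.flow_add_le t x h
    rw [abs_of_nonneg (by linarith : 0 ≤ s - s')]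
    exact le_trans (by linarith) (neg_le_abs _)

lemma flow_strictAnti (hl : NegativeSpeed l C K ε) (t x : ℝ) : StrictAnti (flow l t x) := by
  intro s s' h
  have := hl.flow_add_le t x h.le
  have := mul_pos hl.pos (sub_pos.2 h)
  linarith

lemma exists_flow_eq (hl : NegativeSpeed l C K ε) (t x y : ℝ) : ∃ s, flow l t x s = y := by
  have hε := hl.pos
  -- A time `|x - y| / ε` suffices to descend, or backwards to climb, by `|x - y|`.
  have h0 : 0 ≤ |x - y| / ε := by positivity
  have hm : ε * (|x - y| / ε) = |x - y| := by field_simp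
  have h1 := hl.flow_add_le t x (s := t) (s' := t + |x - y| / ε) (by linarith)
  have h2 := hl.flow_add_le t x (s := t - |x - y| / ε) (s' := t) (by linarith)
  rw [hl.flow_self, add_sub_cancel_left, hm] at h1
  rw [hl.flow_self, sub_sub_cancel, hm] at h2
  have h3 := abs_le.1 (le_refl |x - y|)
  obtain ⟨s, -, hs⟩ := intermediate_value_Icc' (a := t - |x - y| / ε) (b := t + |x - y| / ε)
    (by linarith) (hl.continuous_flow_time t x).continuousOn
    (show y ∈ Icc _ _ from ⟨by linarith, by linarith⟩)
  exact ⟨s, hs⟩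

lemma flow_hitTime (hl : NegativeSpeed l C K ε) (y t x : ℝ) :
    flow l t x (hitTime l y t x) = y :=
  Classical.epsilon_spec (hl.exists_flow_eq t x y)

lemma lt_hitTime_iff (hl : NegativeSpeed l C K ε) (y t x s : ℝ) :
    s < hitTime l y t x ↔ y < flow l t x s := by
  conv_rhs => rw [← hl.flow_hitTime y t x]
  exact (hl.flow_strictAnti t x).lt_iff_gt.symm

lemma hitTime_lt_iff (hl : NegativeSpeed l C K ε) (y t x s : ℝ) :
    hitTime l y t x < s ↔ flow l t x s < y := by
  conv_rhs => rw [← hl.flow_hitTime y t x]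
  exact (hl.flow_strictAnti t x).lt_iff_gt.symm

lemma hitTime_eq (hl : NegativeSpeed l C K ε) {y t x s : ℝ} (h : flow l t x s = y) :
    hitTime l y t x = s :=
  (hl.flow_strictAnti t x).injective ((hl.flow_hitTime y t x).trans h.symm)

lemma hitTime_flow (hl : NegativeSpeed l C K ε) (y t x s : ℝ) :
    hitTime l y s (flow l t x s) = hitTime l y t x :=
  hl.hitTime_eq (by rw [hl.flow_flow, hl.flow_hitTime])

lemma hitTime_self (hl : NegativeSpeed l C K ε) (t x : ℝ) : hitTime l x t x = t :=
  hl.hitTime_eq (hl.flow_self t x)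

lemma continuous_hitTime (hl : NegativeSpeed l C K ε) (y : ℝ) :
    Continuous fun q : ℝ × ℝ => hitTime l y q.1 q.2 := by
  rw [continuous_iff_continuousAt]
  rintro ⟨t, x⟩
  rw [ContinuousAt, tendsto_iff_dist_tendsto_zero]
  have hε := hl.pos
  have hb : ∀ q : ℝ × ℝ, dist (hitTime l y q.1 q.2) (hitTime l y t x) ≤
      |y - flow l q.1 q.2 (hitTime l y t x)| / ε := by
    intro q
    have := hl.mul_abs_sub_le q.1 q.2 (hitTime l y q.1 q.2) (hitTime l y t x)
    rw [hl.flow_hitTime] at this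
    rw [le_div_iff₀ hε, mul_comm]
    exact this
  refine squeeze_zero (fun _ => dist_nonneg) hb ?_
  have hc : Continuous fun q : ℝ × ℝ => |y - flow l q.1 q.2 (hitTime l y t x)| / ε := by
    have := hl.continuous_flow.comp (f := fun q : ℝ × ℝ => (q.1, q.2, hitTime l y t x))
      (by fun_prop)
    exact (continuous_const.sub this).abs.div_const _
  simpa [hl.flow_hitTime] using hc.tendsto (t, x)

/-- At time `s` the trajectories from `(s,x)` and `(s',x)` are at least `ε|s - s'|` apart, and
Gronwall limits how much they can approach each other by time `t`. Hence `s ↦ flow l s x t` can be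
composed with functions defined only almost everywhere. -/
lemma abs_sub_le_mul_flow_initialTime (hl : NegativeSpeed l C K ε) (t x s s' : ℝ) :
    |s - s'| ≤ ε⁻¹ * Real.exp (K * |s - t|) * |flow l s x t - flow l s' x t| := by
  have hε := hl.pos
  have h1 := hl.abs_flow_sub_flow_le s x s' x t s
  have h2 := hl.mul_abs_sub_le s' x s' s
  rw [hl.flow_self, abs_sub_comm] at h2
  rw [hl.flow_self] at h1
  rw [mul_assoc, inv_mul_eq_div, le_div_iff₀ hε]
  linarith

lemma flow_initialTime_strictMono (hl : NegativeSpeed l C K ε) (t y : ℝ) :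
    StrictMono fun s => flow l s y t := by
  intro s s' h
  refine (hl.flow_lt_flow_iff s y s' y s t).2 ?_
  rw [hl.flow_self]
  have := hl.flow_strictAnti s' y h
  rwa [hl.flow_self] at this

lemma flow_initialTime_hitTime (hl : NegativeSpeed l C K ε) (y t x : ℝ) :
    flow l (hitTime l y t x) y t = x := by
  have := hl.flow_flow t x (hitTime l y t x) t
  rwa [hl.flow_hitTime, hl.flow_self] at this

lemma hitTime_initialTime (hl : NegativeSpeed l C K ε) (y s t : ℝ) :
    hitTime l y t (flow l s y t) = s := by
  rw [hl.hitTime_flow, hl.hitTime_self]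

lemma image_flow_initialTime (hl : NegativeSpeed l C K ε) (t x : ℝ) :
    (fun s => flow l s 0 t) '' Ioo t (hitTime l 0 t x) = Ioo 0 x := by
  ext ξ
  have hm := hl.flow_initialTime_strictMono t 0
  constructor
  · rintro ⟨s, hs, rfl⟩
    have h1 := hm hs.1
    have h2 := hm hs.2
    simp only [hl.flow_self, hl.flow_initialTime_hitTime] at h1 h2
    exact ⟨h1, h2⟩
  · intro hξ
    refine ⟨hitTime l 0 t ξ, ⟨?_, ?_⟩, hl.flow_initialTime_hitTime 0 t ξ⟩
    · rw [hl.lt_hitTime_iff, hl.flow_self]; exact hξ.1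
    · refine hm.lt_iff_lt.1 ?_
      simp only [hl.flow_initialTime_hitTime]
      exact hξ.2

/-- The preimage lies in the image of `N` under the differentiable inverse map `s ↦ flow l s y t`,
which sends null sets to null sets. -/
lemma volume_preimage_hitTime (hl : NegativeSpeed l C K ε) (y t : ℝ) {N : Set ℝ}
    (hN : volume N = 0) : volume {x | hitTime l y t x ∈ N} = 0 := by
  have h : volume ((fun s => flow l s y t) '' N) = 0 :=
    addHaar_image_eq_zero_of_differentiableOn_of_addHaar_eq_zero volume
      (fun s _ => (hl.hasDerivAt_flow_initialTime t y s).differentiableAt.differentiableWithinAt) hN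
  refine measure_mono_null ?_ h
  intro x hx
  exact ⟨_, hx, hl.flow_initialTime_hitTime y t x⟩

end NegativeSpeed

/-! ### Compositions with expanding maps, slices and traces -/

/-- A map that does not contract distances on `A` by more than `L` pushes Lebesgue measure on `A`
to a measure with density at most `L`. -/
lemma map_restrict_le_smul_volume {X : ℝ → ℝ} (hX : Measurable X) {A : Set ℝ}
    {L : ℝ} (hL : 0 ≤ L)
    (hXL : ∀ s ∈ A, ∀ s' ∈ A, |s - s'| ≤ L * |X s - X s'|) :
    (volume.restrict A).map X ≤ ENNReal.ofReal L • (volume : Measure ℝ) := by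
  rw [Measure.le_iff]
  intro B hB
  rw [Measure.map_apply hX hB, Measure.restrict_apply (hX hB), Measure.smul_apply, smul_eq_mul]
  set S := X ⁻¹' B ∩ A with hS
  have hinj : InjOn X S := by
    intro s hs s' hs' h
    have := hXL s hs.2 s' hs'.2
    rw [h, sub_self, abs_zero, mul_zero] at this
    exact sub_eq_zero.1 (abs_nonpos_iff.1 this)
  -- The inverse of `X` on `S` is `L`-Lipschitz. Hausdorff measure of dimension one is Lebesgue
  -- measure and bounds the image without any measurability of `X '' S`.
  have hLip : LipschitzOnWith (Real.toNNReal L) (Function.invFunOn X S) (X '' S) := by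
    refine LipschitzOnWith.of_dist_le_mul ?_
    rintro _ ⟨s, hs, rfl⟩ _ ⟨s', hs', rfl⟩
    rw [hinj.leftInvOn_invFunOn hs, hinj.leftInvOn_invFunOn hs', Real.coe_toNNReal _ hL]
    exact hXL s hs.2 s' hs'.2
  have h := hLip.hausdorffMeasure_image_le (d := 1) zero_le_one
  rw [hinj.leftInvOn_invFunOn.image_image, hausdorffMeasure_real, ENNReal.rpow_one] at h
  refine h.trans ?_
  rw [ENNReal.ofReal]
  gcongr
  rintro _ ⟨s, hs, rfl⟩
  exact hs.1

lemma aestronglyMeasurable_comp_of_expanding {Y : ℝ → ℝ} (hY : Measurable Y) {A : Set ℝ} {L : ℝ}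
    (hL : 0 ≤ L) (hYL : ∀ s ∈ A, ∀ s' ∈ A, |s - s'| ≤ L * |Y s - Y s'|) {h : ℝ → ℝ}
    (hh : AEStronglyMeasurable h) :
    AEStronglyMeasurable (fun s => h (Y s)) (volume.restrict A) :=
  ((hh.smul_measure (ENNReal.ofReal L)).mono_measure
    (map_restrict_le_smul_volume hY hL hYL)).comp_measurable hY

lemma lintegral_enorm_comp_le_of_expanding {Y : ℝ → ℝ} (hY : Measurable Y) {A : Set ℝ} {L : ℝ}
    (hL : 0 ≤ L) (hYL : ∀ s ∈ A, ∀ s' ∈ A, |s - s'| ≤ L * |Y s - Y s'|) {h : ℝ → ℝ}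
    (hh : AEStronglyMeasurable h) :
    ∫⁻ s in A, ‖h (Y s)‖ₑ ≤ ENNReal.ofReal L * ∫⁻ s, ‖h s‖ₑ := by
  have hle := map_restrict_le_smul_volume hY hL hYL
  have hh' : AEStronglyMeasurable h ((volume.restrict A).map Y) :=
    (hh.smul_measure (ENNReal.ofReal L)).mono_measure hle
  rw [← lintegral_map' (f := fun s => ‖h s‖ₑ) hh'.enorm hY.aemeasurable]
  refine (lintegral_mono' hle le_rfl).trans ?_
  rw [lintegral_smul_measure, smul_eq_mul]

lemma integrableOn_comp_of_expanding {Y : ℝ → ℝ} (hY : Measurable Y) {A : Set ℝ} {L : ℝ}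
    (hL : 0 ≤ L) (hYL : ∀ s ∈ A, ∀ s' ∈ A, |s - s'| ≤ L * |Y s - Y s'|) {h : ℝ → ℝ}
    (hh : Integrable h) : IntegrableOn (fun s => h (Y s)) A :=
  ⟨aestronglyMeasurable_comp_of_expanding hY hL hYL hh.1,
    (lintegral_enorm_comp_le_of_expanding hY hL hYL hh.1).trans_lt
      (ENNReal.mul_lt_top ENNReal.ofReal_lt_top hh.2)⟩

/-- Limits in `L²` of compositions `f ∘ X n`, with `X n` converging pointwise. -/
lemma ae_eq_comp_of_tendsto {f : ℝ → ℝ} (hf : Integrable f) {A : Set ℝ} (hA : MeasurableSet A)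
    (hA' : volume A ≠ ⊤) {X : ℕ → ℝ → ℝ} {X' : ℝ → ℝ} (hX : ∀ n, Measurable (X n))
    (hX' : Measurable X') {L : ℝ} (hL : 0 ≤ L)
    (hXL : ∀ n, ∀ s ∈ A, ∀ s' ∈ A, |s - s'| ≤ L * |X n s - X n s'|)
    (hXL' : ∀ s ∈ A, ∀ s' ∈ A, |s - s'| ≤ L * |X' s - X' s'|)
    (hlim : ∀ s ∈ A, Tendsto (fun n => X n s) atTop (𝓝 (X' s)))
    {y : ℕ → ℝ → ℝ} {y' : ℝ → ℝ} (hy : ∀ n, y n =ᵐ[volume.restrict A] fun s => f (X n s))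
    (hy' : AEStronglyMeasurable y' (volume.restrict A))
    (hyl : Tendsto (fun n => eLpNorm (fun s => y n s - y' s) 2 (volume.restrict A)) atTop (𝓝 0)) :
    y' =ᵐ[volume.restrict A] fun s => f (X' s) := by
  have : IsFiniteMeasure (volume.restrict A) := ⟨by simpa using hA'.lt_top⟩
  set μ := volume.restrict A with hμ
  have hac : ∀ {Y : ℝ → ℝ}, Measurable Y → (∀ s ∈ A, ∀ s' ∈ A, |s - s'| ≤ L * |Y s - Y s'|) →
      ∀ {h : ℝ → ℝ}, AEStronglyMeasurable h volume →
      AEStronglyMeasurable (fun s => h (Y s)) μ ∧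
      ∫⁻ s, ‖h (Y s)‖ₑ ∂μ ≤ ENNReal.ofReal L * ∫⁻ s, ‖h s‖ₑ := fun hY hYL _ hh =>
    ⟨aestronglyMeasurable_comp_of_expanding hY hL hYL hh,
      lintegral_enorm_comp_le_of_expanding hY hL hYL hh⟩
  obtain ⟨hm', -⟩ := hac hX' hXL' hf.1
  have hyl1 : Tendsto (fun n => eLpNorm (fun s => y n s - y' s) 1 μ) atTop (𝓝 0) := by
    have hc : μ univ ^ (1 / (1 : ENNReal).toReal - 1 / (2 : ENNReal).toReal) ≠ ⊤ :=
      ENNReal.rpow_ne_top_of_nonneg (by norm_num) (measure_ne_top _ _)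
    have h0 := ENNReal.Tendsto.mul_const hyl (Or.inr hc)
    rw [zero_mul] at h0
    refine tendsto_of_tendsto_of_tendsto_of_le_of_le tendsto_const_nhds h0 (fun _ => zero_le) ?_
    intro n
    refine eLpNorm_le_eLpNorm_mul_rpow_measure_univ (by norm_num) ?_
    exact (((hac (hX n) (hXL n) hf.1).1).congr (hy n).symm).sub hy'
  -- `f` is replaced by a continuous compactly supported `g` at L¹ distance `δ`. Both replacements,
  -- along `X n` and along `X'`, cost at most `L * δ` uniformly in `n`, whence the factor `2`.
  have key : ∀ δ : ENNReal, δ ≠ 0 →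
      ∫⁻ s, ‖y' s - f (X' s)‖ₑ ∂μ ≤ 2 * (ENNReal.ofReal L * δ) := by
    intro δ hδ
    obtain ⟨g, hgs, hgf, hgc, hgi⟩ := hf.exists_hasCompactSupport_lintegral_sub_le hδ
    obtain ⟨M, hM⟩ := hgs.exists_bound_of_continuous hgc
    have hgl : Tendsto (fun n => ∫⁻ s, ENNReal.ofReal ‖g (X n s) - g (X' s)‖ ∂μ) atTop (𝓝 0) := by
      refine tendsto_lintegral_norm_of_dominated_convergence (bound := fun _ => M)
        (fun n => (hgc.measurable.comp (hX n)).aestronglyMeasurable)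
        (hasFiniteIntegral_const _) (fun n => ae_of_all _ fun s => hM _) ?_
      refine (ae_restrict_iff' hA).2 (ae_of_all _ fun s hs => ?_)
      exact (hgc.tendsto _).comp (hlim s hs)
    have hsum := (hyl1.add hgl).add_const (2 * (ENNReal.ofReal L * δ))
    rw [add_zero, zero_add] at hsum
    refine ge_of_tendsto' hsum fun n => ?_
    have hfg : AEStronglyMeasurable (fun s => f s - g s) := hf.1.sub hgi.1
    obtain ⟨hmn, hn⟩ := hac (hX n) (hXL n) hfg
    obtain ⟨hmn', hn'⟩ := hac hX' hXL' hfg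
    have hpt : ∀ᵐ s ∂μ, ‖y' s - f (X' s)‖ₑ ≤ ‖y n s - y' s‖ₑ
        + ENNReal.ofReal ‖g (X n s) - g (X' s)‖ + ‖f (X n s) - g (X n s)‖ₑ
        + ‖f (X' s) - g (X' s)‖ₑ := by
      filter_upwards [hy n] with s hs
      have e : y' s - f (X' s) = -(y n s - y' s) + (f (X n s) - g (X n s))
          + (g (X n s) - g (X' s)) + -(f (X' s) - g (X' s)) := by rw [hs]; ring
      rw [e, ofReal_norm]
      refine (enorm_add_le _ _).trans ?_
      rw [enorm_neg]
      gcongr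
      refine (enorm_add_le _ _).trans ?_
      rw [add_right_comm]
      gcongr
      refine (enorm_add_le _ _).trans ?_
      rw [enorm_neg]
    have hgm : Measurable fun s => ENNReal.ofReal ‖g (X n s) - g (X' s)‖ :=
      ((hgc.measurable.comp (hX n)).sub (hgc.measurable.comp hX')).norm.ennreal_ofReal
    refine (lintegral_mono_ae hpt).trans ?_
    rw [lintegral_add_right' _ hmn'.enorm, lintegral_add_right' _ hmn.enorm,
      lintegral_add_right' _ hgm.aemeasurable, eLpNorm_one_eq_lintegral_enorm,
      add_assoc, two_mul]
    gcongr
    · exact hn.trans (by gcongr)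
    · exact hn'.trans (by gcongr)
  have hzero : ∫⁻ s, ‖y' s - f (X' s)‖ₑ ∂μ = 0 := by
    refine le_antisymm (ENNReal.le_of_forall_pos_le_add fun η hη _ => ?_) zero_le
    rw [zero_add]
    -- The added `1` keeps the denominator below nonzero when `L = 0`.
    have hLt : ENNReal.ofReal L + 1 ≠ ⊤ := by simp
    refine (key (η / (2 * (ENNReal.ofReal L + 1))) ?_).trans ?_
    · refine (ENNReal.div_pos (by exact_mod_cast hη.ne') (by finiteness)).ne'
    · rw [← mul_assoc, ← mul_div_assoc]
      refine ENNReal.div_le_of_le_mul ?_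
      rw [mul_comm]
      gcongr
      exact le_self_add
  have hz := (lintegral_eq_zero_iff' (hy'.sub hm').enorm).1 hzero
  filter_upwards [hz] with s hs
  exact sub_eq_zero.1 (by simpa using hs)

lemma mem_closure_inter_of_ae {a b : ℝ} (hab : a < b) {G : Set ℝ}
    (h : ∀ᵐ t ∂(volume.restrict (Ioo a b)), t ∈ G) {t : ℝ} (ht : t ∈ Icc a b) :
    t ∈ closure (Icc a b ∩ G) := by
  rw [mem_closure_iff]
  intro U hU htU
  have hne : (U ∩ Ioo a b).Nonempty := by
    rw [← closure_Ioo hab.ne] at ht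
    exact mem_closure_iff.1 ht U hU htU
  have hpos := (hU.inter isOpen_Ioo).measure_pos volume hne
  rw [ae_restrict_iff' measurableSet_Ioo] at h
  by_contra hcon
  have hsub : U ∩ Ioo a b ⊆ {t | ¬(t ∈ Ioo a b → t ∈ G)} := fun r hr hG =>
    hcon ⟨r, hr.1, Ioo_subset_Icc_self hr.2, hG hr.2⟩
  exact hpos.ne' (measure_mono_null hsub h)

/-- A slice that is a limit of good slices is good: both sides pass to the limit, `y` by L²
continuity and `f ∘ X` by the uniform expansion bound. With a full-measure, hence dense, set of good
slices this reaches every slice, endpoints included. -/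
lemma ContL2.ae_eq_comp {S A G : Set ℝ} {y : ℝ → ℝ → ℝ} (hy : ContL2 S A y) {f : ℝ → ℝ}
    (hf : Integrable f) (hA : MeasurableSet A) (hA' : volume A ≠ ⊤) {X : ℝ → ℝ → ℝ}
    (hX : ∀ r, Measurable (X r)) {L : ℝ} (hL : 0 ≤ L)
    (hXL : ∀ r ∈ S, ∀ s ∈ A, ∀ s' ∈ A, |s - s'| ≤ L * |X r s - X r s'|)
    (hXc : ∀ s, Continuous fun r => X r s)
    (hG : ∀ r ∈ S ∩ G, y r =ᵐ[volume.restrict A] fun s => f (X r s)) {r : ℝ} (hr : r ∈ S)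
    (hrG : r ∈ closure (S ∩ G)) : y r =ᵐ[volume.restrict A] fun s => f (X r s) := by
  obtain ⟨ρ, hρ, hρr⟩ := mem_closure_iff_seq_limit.1 hrG
  have hρ' : Tendsto ρ atTop (𝓝[S] r) :=
    tendsto_nhdsWithin_iff.2 ⟨hρr, Eventually.of_forall fun n => (hρ n).1⟩
  exact ae_eq_comp_of_tendsto hf hA hA' (fun n => hX (ρ n)) (hX r) hL
    (fun n => hXL _ (hρ n).1) (hXL r hr) (fun s _ => ((hXc s).tendsto r).comp hρr)
    (fun n => hG _ (hρ n)) (hy.1 r hr).1 ((hy.2 r hr).comp hρ')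

namespace NegativeSpeed

variable {l : ℝ → ℝ → ℝ} {C K ε : ℝ}

/-- The values at every time `t ≥ t0` of a continuous-in-time function transported by the flow. -/
lemma ae_eq_of_transported (hl : NegativeSpeed l C K ε) {t0 : ℝ} {f : ℝ → ℝ} (hf : Integrable f)
    {y : ℝ → ℝ → ℝ} (hy : ∀ᵐ q : ℝ × ℝ ∂(volume.restrict (Ioi t0 ×ˢ Ioo 0 1)),
      y q.1 q.2 = f (flow l q.1 q.2 t0))
    (hct : ∀ T > 0, ContL2 (Icc t0 (t0 + T)) (Ioo 0 1) y) {t : ℝ} (ht : t0 ≤ t) :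
    y t =ᵐ[volume.restrict (Ioo 0 1)] fun x => f (flow l t x t0) := by
  have hT : 0 < t - t0 + 1 := by linarith
  rw [Measure.volume_eq_prod, ← Measure.prod_restrict] at hy
  have hy1 := Measure.ae_ae_of_ae_prod hy
  have hmem : t ∈ Icc t0 (t0 + (t - t0 + 1)) := ⟨ht, by linarith⟩
  refine (hct _ hT).ae_eq_comp hf measurableSet_Ioo (by simp) (X := fun r x => flow l r x t0)
    (L := Real.exp (K * (t - t0 + 1)))
    (G := {r | ∀ᵐ x ∂(volume.restrict (Ioo 0 1)), y r x = f (flow l r x t0)})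
    (fun r => ?_) (Real.exp_pos _).le ?_ (fun s => ?_) (fun r hr => hr.2) hmem
    (mem_closure_inter_of_ae (by linarith) ?_ hmem)
  · exact (hl.continuous_flow.comp (f := fun x : ℝ => (r, x, t0)) (by fun_prop)).measurable
  · intro r hr x _ x' _
    have h := hl.abs_flow_sub_flow_le r x r x' t0 r
    rw [hl.flow_self, hl.flow_self] at h
    rw [mul_comm]
    refine h.trans ?_
    have := hl.K_nonneg
    gcongr
    rw [abs_of_nonneg (by linarith [hr.1])]
    linarith [hr.2]
  · exact hl.continuous_flow.comp (f := fun r : ℝ => (r, s, t0)) (by fun_prop)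
  · exact ae_restrict_of_ae_restrict_of_subset Ioo_subset_Ioi_self hy1

/-- The trace at `x = 0` of a continuous-in-space function transported by the flow. -/
lemma ae_trace_eq_of_transported (hl : NegativeSpeed l C K ε) {t0 : ℝ} {f : ℝ → ℝ}
    (hf : Integrable f) {y : ℝ → ℝ → ℝ}
    (hy : ∀ᵐ q : ℝ × ℝ ∂(volume.restrict (Ioi t0 ×ˢ Ioo 0 1)),
      y q.1 q.2 = f (flow l q.1 q.2 t0))
    (hcx : ∀ T > 0, ContL2 (Icc 0 1) (Ioo t0 (t0 + T)) (fun x t => y t x)) :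
    ∀ᵐ s ∂(volume.restrict (Ioi t0)), y s 0 = f (flow l s 0 t0) := by
  have hU : Ioi t0 = ⋃ n : ℕ, Ioo t0 (t0 + (n + 1)) := by
    ext s
    simp only [mem_Ioi, mem_iUnion, mem_Ioo]
    refine ⟨fun h => ?_, fun ⟨n, h⟩ => h.1⟩
    obtain ⟨n, hn⟩ := exists_nat_gt (s - t0)
    exact ⟨n, h, by linarith⟩
  rw [hU, ae_restrict_iUnion_iff]
  intro n
  have hn : (0 : ℝ) < n + 1 := by positivity
  rw [Measure.volume_eq_prod, ← Measure.prod_restrict] at hy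
  have hy1 := Measure.ae_ae_of_ae_prod (Measure.measurePreserving_swap.quasiMeasurePreserving.ae hy)
  have hε := hl.pos
  refine (hcx _ hn).ae_eq_comp hf measurableSet_Ioo (by simp) (X := fun x s => flow l s x t0)
    (L := ε⁻¹ * Real.exp (K * (n + 1)))
    (G := {x | ∀ᵐ s ∂(volume.restrict (Ioi t0)), y s x = f (flow l s x t0)})
    (fun x => ?_) (by positivity) ?_ (fun s => ?_)
    (fun r hr => ae_restrict_of_ae_restrict_of_subset Ioo_subset_Ioi_self hr.2)
    (left_mem_Icc.2 zero_le_one)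
    (mem_closure_inter_of_ae zero_lt_one ?_ (left_mem_Icc.2 zero_le_one))
  · exact (hl.continuous_flow.comp (f := fun s : ℝ => (s, x, t0)) (by fun_prop)).measurable
  · intro x _ s hs s' _
    refine (hl.abs_sub_le_mul_flow_initialTime t0 x s s').trans ?_
    have := hl.K_nonneg
    gcongr
    rw [abs_of_nonneg (by linarith [hs.1])]
    linarith [hs.2]
  · exact hl.continuous_flow.comp (f := fun r : ℝ => (s, r, t0)) (by fun_prop)
  · exact hy1

/-- The boundary data generated by initial data supported in `(0,1]`. -/
lemma integrable_flow_initialTime (hl : NegativeSpeed l C K ε) (t0 : ℝ) {f : ℝ → ℝ}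
    (hf : Integrable f) (hsupp : ∀ x, x ∉ Ioc (0 : ℝ) 1 → f x = 0) :
    Integrable fun s => f (flow l s 0 t0) := by
  have hε := hl.pos
  -- For `s` outside this compact window the characteristic through `(s,0)` is outside `[0,1]` at
  -- time `t0`, where `f` vanishes.
  set A := Icc t0 (hitTime l 0 t0 1)
  have hA : IntegrableOn (fun s => f (flow l s 0 t0)) A := by
    refine integrableOn_comp_of_expanding (Y := fun s => flow l s 0 t0)
      (hl.continuous_flow.comp (f := fun s : ℝ => (s, (0 : ℝ), t0)) (by fun_prop)).measurable
      (L := ε⁻¹ * Real.exp (K * (hitTime l 0 t0 1 - t0))) (by positivity) ?_ hf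
    intro s hs s' _
    refine (hl.abs_sub_le_mul_flow_initialTime t0 0 s s').trans ?_
    have := hl.K_nonneg
    gcongr
    rw [abs_of_nonneg (by linarith [hs.1])]
    linarith [hs.2]
  refine (integrableOn_iff_integrable_of_support_subset fun s hs => ?_).1 hA
  have h1 : flow l s 0 t0 ∈ Ioc (0 : ℝ) 1 := by
    by_contra h
    exact hs (hsupp _ h)
  have hm := hl.flow_initialTime_strictMono t0 0
  constructor
  · refine hm.le_iff_le.1 ?_
    simp only [hl.flow_self]
    exact h1.1.le
  · refine hm.le_iff_le.1 ?_
    simp only [hl.flow_initialTime_hitTime]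
    exact h1.2

end NegativeSpeed

/-! ### Integrals along characteristics up to the exit time -/

/-- For fixed `s` the truncated integrand is discontinuous in `q` only where `a q = s`. At a given
`q` this excludes one value of `s`, so dominated convergence applies. -/
lemma continuous_setIntegral_Iic {T : Type*} [TopologicalSpace T] [FirstCountableTopology T]
    {a : T → ℝ} (ha : Continuous a) {F : T → ℝ → ℝ} (hF : ∀ q, AEStronglyMeasurable (F q))
    (hFc : ∀ s, Continuous fun q => F q s) {b : ℝ → ℝ} (hb : Integrable b)
    (hFb : ∀ q s, |F q s| ≤ b s) : Continuous fun q => ∫ s in Iic (a q), F q s := by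
  simp_rw [← integral_indicator measurableSet_Iic]
  refine continuous_iff_continuousAt.2 fun q => ?_
  refine continuousAt_of_dominated (bound := b)
    (Eventually.of_forall fun q => (hF q).indicator measurableSet_Iic)
    (Eventually.of_forall fun q => ae_of_all _ fun s => ?_) hb ?_
  · refine le_trans ?_ (hFb q s)
    exact norm_indicator_le_norm_self _ _
  · have hne : ∀ᵐ s : ℝ, s ≠ a q := by simp [ae_iff]
    filter_upwards [hne] with s hs
    rcases lt_or_gt_of_ne hs with h | h
    · refine (hFc s).continuousAt.congr ?_
      filter_upwards [ha.continuousAt.eventually (lt_mem_nhds h)] with q' hq'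
      rw [indicator_of_mem (show s ∈ Iic (a q') from le_of_lt hq')]
    · refine (continuousAt_const (y := (0 : ℝ))).congr ?_
      filter_upwards [ha.continuousAt.eventually (gt_mem_nhds h)] with q' hq'
      rw [indicator_of_notMem (show s ∉ Iic (a q') from not_le.2 hq')]

/-- The integral of `g u` along the trajectory of `l` from `(t,x)` until it reaches `0`. -/
def outflowIntegral (l g : ℝ → ℝ → ℝ) (u : ℝ → ℝ) (t x : ℝ) : ℝ :=
  ∫ s in t..hitTime l 0 t x, g s (flow l t x s) * u s

namespace NegativeSpeed

variable {l : ℝ → ℝ → ℝ} {C K ε : ℝ} {g : ℝ → ℝ → ℝ} {u : ℝ → ℝ} {M : ℝ}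

lemma integrable_mul_along_flow (hl : NegativeSpeed l C K ε)
    (hg : Continuous fun q : ℝ × ℝ => g q.1 q.2) (hgM : ∀ s y, |g s y| ≤ M) (hu : Integrable u)
    (t x : ℝ) : Integrable fun s => g s (flow l t x s) * u s := by
  refine hu.bdd_mul (c := M) ?_ (ae_of_all _ fun s => hgM _ _)
  exact (hg.comp (f := fun s : ℝ => (s, flow l t x s))
    (continuous_id.prodMk (hl.continuous_flow_time t x))).aestronglyMeasurable

lemma continuous_outflowIntegral (hl : NegativeSpeed l C K ε)
    (hg : Continuous fun q : ℝ × ℝ => g q.1 q.2) (hgM : ∀ s y, |g s y| ≤ M) (hu : Integrable u) :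
    Continuous fun q : ℝ × ℝ => outflowIntegral l g u q.1 q.2 := by
  have hint := fun q : ℝ × ℝ => hl.integrable_mul_along_flow hg hgM hu q.1 q.2
  have h : ∀ {a : ℝ × ℝ → ℝ}, Continuous a →
      Continuous fun q : ℝ × ℝ => ∫ s in Iic (a q), g s (flow l q.1 q.2 s) * u s := by
    intro a ha
    refine continuous_setIntegral_Iic ha (fun q => (hint q).1) (fun s => ?_)
      (b := fun s => M * |u s|) (hu.abs.const_mul M) (fun q s => ?_)
    · refine Continuous.mul ?_ continuous_const
      refine hg.comp (f := fun q : ℝ × ℝ => (s, flow l q.1 q.2 s)) ?_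
      exact continuous_const.prodMk
        (hl.continuous_flow.comp (f := fun q : ℝ × ℝ => (q.1, q.2, s)) (by fun_prop))
    · rw [abs_mul]
      gcongr
      exact hgM _ _
  refine ((h (hl.continuous_hitTime 0)).sub (h continuous_fst)).congr fun q => ?_
  exact intervalIntegral.integral_Iic_sub_Iic (hint q).integrableOn (hint q).integrableOn

/-- All points of a characteristic share its exit time. This is the integrated form of `∂_t W + l
∂_x W = -g u`. -/
lemma outflowIntegral_flow (hl : NegativeSpeed l C K ε)
    (hg : Continuous fun q : ℝ × ℝ => g q.1 q.2) (hgM : ∀ s y, |g s y| ≤ M) (hu : Integrable u)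
    (t x r : ℝ) : outflowIntegral l g u r (flow l t x r)
      = (∫ s in r..t, g s (flow l t x s) * u s) + outflowIntegral l g u t x := by
  have hint := hl.integrable_mul_along_flow hg hgM hu t x
  unfold outflowIntegral
  rw [intervalIntegral.integral_add_adjacent_intervals hint.intervalIntegrable
    hint.intervalIntegrable, hl.hitTime_flow]
  simp only [hl.flow_flow]

end NegativeSpeed

/-! ### Explicit form of the kernel and its action on transported data -/

/-- The extension to `ℝ²` of a function on `[0,+∞) × [0,1]` by projection. -/
def stripExtend (g : ℝ → ℝ → ℝ) (t x : ℝ) : ℝ := g (max 0 t) (max 0 (min 1 x))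

lemma stripExtend_eq (g : ℝ → ℝ → ℝ) {t x : ℝ} (ht : 0 ≤ t) (hx : x ∈ Icc (0 : ℝ) 1) :
    stripExtend g t x = g t x := by
  rw [stripExtend, max_eq_right ht, min_eq_right hx.2, max_eq_right hx.1]

lemma ContBddStrip.continuous_stripExtend {g : ℝ → ℝ → ℝ} (hg : ContBddStrip g) :
    Continuous fun q : ℝ × ℝ => stripExtend g q.1 q.2 :=
  hg.1.comp_continuous (f := fun q : ℝ × ℝ => (max 0 q.1, max 0 (min 1 q.2))) (by fun_prop)
    fun q => ⟨mem_Ici.2 (le_max_left _ _), le_max_left _ _, max_le zero_le_one (min_le_left _ _)⟩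

lemma ContBddStrip.exists_abs_stripExtend_le {g : ℝ → ℝ → ℝ} (hg : ContBddStrip g) :
    ∃ M, ∀ t x, |stripExtend g t x| ≤ M :=
  hg.2.imp fun _ h _ _ => h _ (mem_Ici.2 (le_max_left _ _)) _
    ⟨le_max_left _ _, max_le zero_le_one (min_le_left _ _)⟩

lemma AdmissibleSpeeds.exists_negativeSpeed {m p : ℕ} {Λ : StateIdx m p → ℝ → ℝ → ℝ}
    (hΛ : AdmissibleSpeeds Λ) :
    ∃ C K ε : ℝ, ∀ i : Fin m, NegativeSpeed (Λ (Sum.inl i)) C K ε := by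
  obtain ⟨C, hC⟩ := hΛ.bounded
  obtain ⟨K, hK⟩ := hΛ.bounded_deriv
  obtain ⟨ε, hε, h⟩ := hΛ.speeds
  exact ⟨C, K, ε, fun i => ⟨⟨hΛ.contDiff _, hC _, hK _⟩, hε, fun t x => (h t x).1 i⟩⟩

/-- The solution of the kernel equation for the pair of speeds `li`, `lj`. -/
def explicitKernel (li lj g : ℝ → ℝ → ℝ) (t x ξ : ℝ) : ℝ :=
  if hitTime lj 0 t ξ < hitTime li 0 t x then
    -(g (hitTime lj 0 t ξ) (flow li t x (hitTime lj 0 t ξ)) / lj (hitTime lj 0 t ξ) 0)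
      * Real.exp (∫ r in t..hitTime lj 0 t ξ, deriv (lj r) (flow lj t ξ r))
  else 0

lemma eq_mul_exp_of_linear_ode {η a : ℝ → ℝ} (ha : Continuous a) {e o : ℝ}
    (hη : ∀ s ∈ Icc e o, HasDerivWithinAt η (-a s * η s) (Icc e o) s) {t : ℝ}
    (ht : t ∈ Icc e o) : η t = η o * Real.exp (∫ r in t..o, a r) := by
  have hI : ∀ s, HasDerivAt (fun s => ∫ r in t..s, a r) (a s) s := fun s =>
    (ha.integral_hasStrictDerivAt t s).hasDerivAt
  set E := fun s => η s * Real.exp (∫ r in t..s, a r) with hE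
  have hE' : ∀ s ∈ Icc e o, HasDerivWithinAt E 0 (Icc e o) s := fun s hs => by
    refine ((hη s hs).fun_mul ((hI s).exp.hasDerivWithinAt)).congr_deriv ?_
    ring
  have hconst := constant_of_derivWithin_zero (fun s hs => (hE' s hs).differentiableWithinAt)
    fun s hs => (hE' s (Ico_subset_Icc_self hs)).derivWithin
      (uniqueDiffOn_Icc (hs.1.trans_lt hs.2) s (Ico_subset_Icc_self hs))
  have h1 := (hconst t ht).trans (hconst o ⟨ht.1.trans ht.2, le_rfl⟩).symm
  simpa [hE] using h1

namespace IsKernelSolution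

variable {m p : ℕ} {Λ : StateIdx m p → ℝ → ℝ → ℝ} {g : ℝ → ℝ → Matrix (Fin m) (Fin m) ℝ}
  {h : ℝ → ℝ → ℝ → Matrix (Fin m) (Fin m) ℝ} {C K ε : ℝ}

/-- The kernel equations are indexed by interior points at positive times, but their time interval
depends only on the pair of characteristics. An auxiliary time `t'` thus gives access to boundary
points and to `t = 0`. -/
lemma eq_explicitKernel_of_interior (hh : IsKernelSolution Λ g h)
    (hl : ∀ i : Fin m, NegativeSpeed (Λ (Sum.inl i)) C K ε) (i j : Fin m) {t x ξ t' : ℝ}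
    (ht : 0 ≤ t) (hx : x ∈ Icc (0 : ℝ) 1) (hξ : ξ ∈ Icc (0 : ℝ) 1) (ht' : 0 < t')
    (hx' : flow (Λ (Sum.inl i)) t x t' ∈ Ioo (0 : ℝ) 1)
    (hξ' : flow (Λ (Sum.inl j)) t ξ t' ∈ Ioo (0 : ℝ) 1)
    (hne : hitTime (Λ (Sum.inl i)) 0 t x ≠ hitTime (Λ (Sum.inl j)) 0 t ξ) :
    h t x ξ i j = explicitKernel (Λ (Sum.inl i)) (Λ (Sum.inl j))
      (stripExtend fun t x => g t x i j) t x ξ := by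
  have hi := hl i
  have hj := hl j
  have hode := hh.ode i j t' ht' _ hx' _ hξ'
  have hval := hh.exit_value i j t' ht' _ hx' _ hξ'
  have e1 : exitTime Λ (Sum.inl i) t' (flow (Λ (Sum.inl i)) t x t') =
    hitTime (Λ (Sum.inl i)) 0 t x := hi.hitTime_flow 0 t x t'
  have e2 : exitTime Λ (Sum.inl j) t' (flow (Λ (Sum.inl j)) t ξ t') =
    hitTime (Λ (Sum.inl j)) 0 t ξ := hj.hitTime_flow 0 t ξ t'
  have e3 : entryTime Λ (Sum.inl i) t' (flow (Λ (Sum.inl i)) t x t') =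
    hitTime (Λ (Sum.inl i)) 1 t x := hi.hitTime_flow 1 t x t'
  have e4 : entryTime Λ (Sum.inl j) t' (flow (Λ (Sum.inl j)) t ξ t') =
    hitTime (Λ (Sum.inl j)) 1 t ξ := hj.hitTime_flow 1 t ξ t'
  simp only [kernelExitValue, entryTime₂, exitTime₂, e1, e2, e3, e4, chi, hi.flow_flow,
    hj.flow_flow] at hode hval
  specialize hode hne
  specialize hval hne
  set τi := hitTime (Λ (Sum.inl i)) 0 t x with hτi
  set τj := hitTime (Λ (Sum.inl j)) 0 t ξ with hτj
  have hti : t ≤ τi := by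
    rw [← not_lt, hτi, hi.hitTime_lt_iff, hi.flow_self]; exact not_lt.2 hx.1
  have htj : t ≤ τj := by
    rw [← not_lt, hτj, hj.hitTime_lt_iff, hj.flow_self]; exact not_lt.2 hξ.1
  have hti' : hitTime (Λ (Sum.inl i)) 1 t x ≤ t := by
    rw [← not_lt, hi.lt_hitTime_iff, hi.flow_self]; exact not_lt.2 hx.2
  have htj' : hitTime (Λ (Sum.inl j)) 1 t ξ ≤ t := by
    rw [← not_lt, hj.lt_hitTime_iff, hj.flow_self]; exact not_lt.2 hξ.2
  have ha : Continuous fun s => deriv (Λ (Sum.inl j) s) (flow (Λ (Sum.inl j)) t ξ s) :=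
    hj.continuous_deriv.comp (f := fun s : ℝ => (s, flow (Λ (Sum.inl j)) t ξ s))
      (continuous_id.prodMk (hj.continuous_flow_time t ξ))
  have hsol := eq_mul_exp_of_linear_ode ha hode (t := t)
    ⟨max_le ht (max_le hti' htj'), le_min hti htj⟩
  rw [hi.flow_self, hj.flow_self, hval] at hsol
  rw [hsol, explicitKernel, ← hτi, ← hτj]
  rcases lt_or_gt_of_ne hne with hlt | hlt
  · rw [if_pos hlt, if_neg hlt.not_gt, zero_mul]
  · rw [if_neg hlt.not_gt, if_pos hlt, min_eq_right hlt.le, stripExtend_eq _ (ht.trans htj)]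
    constructor
    · exact ((hi.lt_hitTime_iff 0 t x τj).1 hlt).le
    · have := (hi.flow_strictAnti t x).antitone htj
      rw [hi.flow_self] at this
      exact this.trans hx.2

lemma eq_explicitKernel (hh : IsKernelSolution Λ g h)
    (hl : ∀ i : Fin m, NegativeSpeed (Λ (Sum.inl i)) C K ε) (i j : Fin m) {t x ξ : ℝ}
    (ht : 0 ≤ t) (hx : x ∈ Icc (0 : ℝ) 1) (htx : 0 < t ∨ 0 < x) (hξ : ξ ∈ Ioo (0 : ℝ) 1)
    (hne : hitTime (Λ (Sum.inl i)) 0 t x ≠ hitTime (Λ (Sum.inl j)) 0 t ξ) :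
    h t x ξ i j = explicitKernel (Λ (Sum.inl i)) (Λ (Sum.inl j))
      (stripExtend fun t x => g t x i j) t x ξ := by
  have hi := hl i
  have hj := hl j
  have hfi : Tendsto (flow (Λ (Sum.inl i)) t x) (𝓝 t) (𝓝 x) := by
    simpa [hi.flow_self] using (hi.continuous_flow_time t x).tendsto t
  have hfj : Tendsto (flow (Λ (Sum.inl j)) t ξ) (𝓝 t) (𝓝 ξ) := by
    simpa [hj.flow_self] using (hj.continuous_flow_time t ξ).tendsto t
  have hevj := hfj.eventually (Ioo_mem_nhds hξ.1 hξ.2)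
  obtain ⟨t', ht', hx', hξ'⟩ : ∃ t' > 0, flow (Λ (Sum.inl i)) t x t' ∈ Ioo (0 : ℝ) 1 ∧
      flow (Λ (Sum.inl j)) t ξ t' ∈ Ioo (0 : ℝ) 1 := by
    -- From `x = 0` the interior is reached by going back in time, which needs `t > 0`; from `x > 0`
    -- by going forward, which also covers `x = 1` and `t = 0`. The corner `t = x = 0` admits
    -- neither.
    rcases hx.1.eq_or_lt with h0 | h0
    · have ht0 : 0 < t := htx.resolve_right (by rw [← h0]; exact lt_irrefl _)
      have hev : ∀ᶠ s in 𝓝 t, 0 < s ∧ flow (Λ (Sum.inl i)) t x s < 1 ∧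
          flow (Λ (Sum.inl j)) t ξ s ∈ Ioo (0 : ℝ) 1 :=
        (lt_mem_nhds ht0).and ((hfi.eventually (gt_mem_nhds (by rw [← h0]; norm_num))).and hevj)
      obtain ⟨s, ⟨h1, h2, h3⟩, hs⟩ :=
        ((hev.filter_mono nhdsWithin_le_nhds).and (self_mem_nhdsWithin (s := Iio t))).exists
      have := hi.flow_strictAnti t x hs
      rw [hi.flow_self, ← h0] at this
      exact ⟨s, h1, ⟨h0 ▸ this, h2⟩, h3⟩
    · have hev : ∀ᶠ s in 𝓝 t, 0 < flow (Λ (Sum.inl i)) t x s ∧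
          flow (Λ (Sum.inl j)) t ξ s ∈ Ioo (0 : ℝ) 1 :=
        (hfi.eventually (lt_mem_nhds h0)).and hevj
      obtain ⟨s, ⟨h1, h2⟩, hs⟩ :=
        ((hev.filter_mono nhdsWithin_le_nhds).and (self_mem_nhdsWithin (s := Ioi t))).exists
      have := hi.flow_strictAnti t x hs
      rw [hi.flow_self] at this
      exact ⟨s, ht.trans_lt hs, ⟨h1, this.trans_le hx.2⟩, h2⟩
  exact hh.eq_explicitKernel_of_interior hl i j ht hx (Ioo_subset_Icc_self hξ) ht' hx' hξ' hne

/-- The kernel vanishes on the boundary `x = 0`. -/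
lemma eq_zero_of_left (hh : IsKernelSolution Λ g h)
    (hl : ∀ i : Fin m, NegativeSpeed (Λ (Sum.inl i)) C K ε) (i j : Fin m) {t ξ : ℝ}
    (ht : 0 < t) (hξ : ξ ∈ Ioo (0 : ℝ) 1) : h t 0 ξ i j = 0 := by
  have h1 : t < hitTime (Λ (Sum.inl j)) 0 t ξ := by
    rw [(hl j).lt_hitTime_iff, (hl j).flow_self]; exact hξ.1
  rw [hh.eq_explicitKernel hl i j ht.le (left_mem_Icc.2 zero_le_one) (Or.inl ht) hξ
    (by rw [(hl i).hitTime_self]; exact h1.ne), explicitKernel, (hl i).hitTime_self,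
    if_neg h1.not_gt]

/-- The integral of the kernel against a transported function, by the change of variables
`ξ = χⱼ(t;s,0)`. -/
lemma integral_mul_transported (hh : IsKernelSolution Λ g h)
    (hl : ∀ i : Fin m, NegativeSpeed (Λ (Sum.inl i)) C K ε)
    (hg : ∀ i j, ContBddStrip fun t x => g t x i j) (i j : Fin m) {t0 t x : ℝ}
    (ht0 : 0 ≤ t0) (ht : t0 ≤ t) (hx : x ∈ Icc (0 : ℝ) 1) (htx : 0 < t ∨ 0 < x) {f v : ℝ → ℝ}
    (hf : Integrable f) (hsupp : ∀ x, x ∉ Ioc (0 : ℝ) 1 → f x = 0)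
    (hv : v =ᵐ[volume.restrict (Ioo 0 1)] fun ξ => f (flow (Λ (Sum.inl j)) t ξ t0)) :
    IntegrableOn (fun ξ => h t x ξ i j * v ξ) (Ioo 0 1) ∧
    ∫ ξ in (0 : ℝ)..1, h t x ξ i j * v ξ
      = outflowIntegral (Λ (Sum.inl i)) (stripExtend fun t x => g t x i j)
          (fun s => f (flow (Λ (Sum.inl j)) s 0 t0)) t x := by
  have hi := hl i
  have hj := hl j
  set li := Λ (Sum.inl i)
  set lj := Λ (Sum.inl j)
  set g' := stripExtend fun t x => g t x i j with hg'
  set u := fun s => f (flow lj s 0 t0) with hu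
  set τi := hitTime li 0 t x with hτi
  set τ1 := hitTime lj 0 t 1 with hτ1
  set S := Ioo t τ1 with hS
  set X := fun s => flow lj s 0 t with hX
  set X' := fun s => -(lj s 0) * Real.exp (∫ r in s..t, deriv (lj r) (flow lj s 0 r)) with hX'
  obtain ⟨M, hM⟩ := (hg i j).exists_abs_stripExtend_le
  have hui : Integrable u := hj.integrable_flow_initialTime t0 hf hsupp
  have hint : Integrable fun s => g' s (flow li t x s) * u s :=
    hi.integrable_mul_along_flow (hg i j).continuous_stripExtend hM hui t x
  have hXd : ∀ s ∈ S, HasDerivWithinAt X (X' s) S s := fun s _ =>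
    (hj.hasDerivAt_flow_initialTime t 0 s).hasDerivWithinAt
  have hXi : InjOn X S := (hj.flow_initialTime_strictMono t 0).injective.injOn
  have hXS : X '' S = Ioo 0 1 := hj.image_flow_initialTime t 1
  have hmeq : (fun ξ => h t x ξ i j * v ξ) =ᵐ[volume.restrict (Ioo 0 1)]
      fun ξ => h t x ξ i j * f (flow lj t ξ t0) := by
    filter_upwards [hv] with ξ hξ
    rw [hξ]
  have hne : ∀ᵐ s : ℝ, s ≠ τi := by simp [ae_iff]
  have hne1 : ∀ᵐ s : ℝ, s ≠ τ1 := by simp [ae_iff]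
  -- The Jacobian is `-λ_j(s,0)` times the inverse of the kernel's exponential, so only `g u`
  -- survives. Past `τi` the characteristic in `x` exits first and the kernel is zero.
  have hpt : (fun s => |X' s| • (h t x (X s) i j * f (flow lj t (X s) t0)))
      =ᵐ[volume.restrict S]
      (Iio τi).indicator (fun s => g' s (flow li t x s) * u s) := by
    filter_upwards [ae_restrict_mem measurableSet_Ioo, ae_restrict_of_ae hne] with s hs hsi
    have hXs : X s ∈ Ioo (0 : ℝ) 1 := hXS ▸ mem_image_of_mem X hs
    have hhit : hitTime lj 0 t (X s) = s := hj.hitTime_initialTime 0 s t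
    have hflow : ∀ r, flow lj t (X s) r = flow lj s 0 r := fun r => hj.flow_flow s 0 t r
    have hlneg : lj s 0 < 0 := (hj.lt_neg s 0).trans (neg_lt_zero.2 hj.pos)
    have hXpos : 0 < X' s := mul_pos (neg_pos.2 hlneg) (Real.exp_pos _)
    rw [hh.eq_explicitKernel hl i j (ht0.trans ht) hx htx hXs (by
      change τi ≠ hitTime lj 0 t (X s)
      rw [hhit]; exact hsi.symm)]
    change |X' s| • (explicitKernel li lj g' t x (X s) * _) = _
    rw [explicitKernel, hhit]
    simp only [hflow]
    rcases lt_or_gt_of_ne hsi with hlt | hlt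
    · rw [if_pos hlt, indicator_of_mem (show s ∈ Iio τi from hlt), abs_of_pos hXpos, smul_eq_mul]
      have hexp : Real.exp (∫ r in s..t, deriv (lj r) (flow lj s 0 r))
          * Real.exp (∫ r in t..s, deriv (lj r) (flow lj s 0 r)) = 1 := by
        rw [← Real.exp_add, intervalIntegral.integral_symm t s, neg_add_cancel, Real.exp_zero]
      calc _ = (g' s (flow li t x s) * u s) * (lj s 0 / lj s 0) *
            (Real.exp (∫ r in s..t, deriv (lj r) (flow lj s 0 r))
              * Real.exp (∫ r in t..s, deriv (lj r) (flow lj s 0 r))) := by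
            simp only [hX', hu]; ring
        _ = _ := by rw [hexp, div_self hlneg.ne]; ring
    · rw [if_neg hlt.not_gt, indicator_of_notMem (show s ∉ Iio τi from not_lt.2 hlt.le),
        zero_mul, smul_zero]
  constructor
  · rw [IntegrableOn, integrable_congr hmeq, ← IntegrableOn, ← hXS,
      integrableOn_image_iff_integrableOn_abs_deriv_smul measurableSet_Ioo hXd hXi, IntegrableOn,
      integrable_congr hpt]
    exact (hint.indicator measurableSet_Iio).integrableOn
  · have hti : t ≤ τi := by
      rw [← not_lt, hτi, hi.hitTime_lt_iff, hi.flow_self]; exact not_lt.2 hx.1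
    rw [intervalIntegral.integral_of_le zero_le_one, integral_Ioc_eq_integral_Ioo,
      integral_congr_ae hmeq, ← hXS,
      integral_image_eq_integral_abs_deriv_smul measurableSet_Ioo hXd hXi, integral_congr_ae hpt,
      outflowIntegral, intervalIntegral.integral_of_le hti, ← integral_indicator measurableSet_Ioo,
      ← integral_indicator measurableSet_Ioc]
    -- The domains `S ∩ Iio τi` and `Ioc t τi` differ, up to null sets, only by times `s > τ1`. The
    -- characteristic through `(s,0)` is then beyond `1` at time `t`, and still further right at `t0
    -- ≤ t`, so `u s = 0`.
    refine integral_congr_ae ?_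
    filter_upwards [hne, hne1] with s hsi hs1
    by_cases h1 : s ∈ Ioc t τi
    · rw [indicator_of_mem h1]
      have h2 : s < τi := lt_of_le_of_ne h1.2 hsi
      by_cases h3 : s ∈ S
      · rw [indicator_of_mem h3, indicator_of_mem (show s ∈ Iio τi from h2)]
      · rw [indicator_of_notMem h3]
        have h4 : τ1 < s := lt_of_le_of_ne (not_lt.1 fun h => h3 ⟨h1.1, h⟩) hs1.symm
        have h5 : 1 < flow lj s 0 t := by
          have := hj.flow_initialTime_strictMono t 0 h4
          simpa only [hτ1, hj.flow_initialTime_hitTime] using this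
        have h6 : 1 < flow lj s 0 t0 := h5.trans_le ((hj.flow_strictAnti s 0).antitone ht)
        have h7 : u s = 0 := hsupp _ fun h => (not_lt.2 h.2) h6
        rw [h7, mul_zero]
    · rw [indicator_of_notMem h1]
      by_cases h3 : s ∈ S
      · rw [indicator_of_mem h3, indicator_of_notMem]
        exact fun h => h1 ⟨h3.1, le_of_lt h⟩
      · rw [indicator_of_notMem h3]

/-- At a fixed time the kernel is measurable and essentially bounded. -/
lemma measurable_bounded_slice (hh : IsKernelSolution Λ g h)
    (hl : ∀ i : Fin m, NegativeSpeed (Λ (Sum.inl i)) C K ε)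
    (hg : ∀ i j, ContBddStrip fun t x => g t x i j) (i j : Fin m) {t : ℝ} (ht : 0 ≤ t) :
    AEStronglyMeasurable (fun q : ℝ × ℝ => h t q.1 q.2 i j)
      ((volume.restrict (Ioo 0 1)).prod (volume.restrict (Ioo 0 1))) ∧
    ∃ M, ∀ᵐ q : ℝ × ℝ ∂((volume.restrict (Ioo 0 1)).prod (volume.restrict (Ioo 0 1))),
      ‖h t q.1 q.2 i j‖ ≤ M := by
  have hi := hl i
  have hj := hl j
  have hε := hj.pos
  set li := Λ (Sum.inl i)
  set lj := Λ (Sum.inl j)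
  set g' := stripExtend fun t x => g t x i j with hg'
  obtain ⟨M, hM⟩ := (hg i j).exists_abs_stripExtend_le
  have hM0 : 0 ≤ M := (abs_nonneg _).trans (hM 0 0)
  have hci : Continuous fun q : ℝ × ℝ => hitTime li 0 t q.1 :=
    (hi.continuous_hitTime 0).comp (f := fun q : ℝ × ℝ => (t, q.1)) (by fun_prop)
  have hcj : Continuous fun q : ℝ × ℝ => hitTime lj 0 t q.2 :=
    (hj.continuous_hitTime 0).comp (f := fun q : ℝ × ℝ => (t, q.2)) (by fun_prop)
  have hae : ∀ᵐ q : ℝ × ℝ ∂((volume.restrict (Ioo 0 1)).prod (volume.restrict (Ioo 0 1))),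
      q ∈ Ioo (0 : ℝ) 1 ×ˢ Ioo (0 : ℝ) 1 ∧
      h t q.1 q.2 i j = explicitKernel li lj g' t q.1 q.2 := by
    -- For each `x`, equal exit times confine `ξ` to the preimage of a single time, a null set.
    have h1 : ∀ᵐ q : ℝ × ℝ ∂((volume.restrict (Ioo 0 1)).prod (volume.restrict (Ioo 0 1))),
        hitTime li 0 t q.1 ≠ hitTime lj 0 t q.2 := by
      have hms : MeasurableSet {q : ℝ × ℝ | hitTime li 0 t q.1 = hitTime lj 0 t q.2} :=
        (isClosed_eq hci hcj).measurableSet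
      rw [ae_iff]
      simp only [not_not]
      rw [Measure.measure_prod_null hms]
      refine Eventually.of_forall fun x => ?_
      refine nonpos_iff_eq_zero.1 ((Measure.restrict_apply_le _ _).trans (le_of_eq ?_))
      refine measure_mono_null ?_ (hj.volume_preimage_hitTime 0 t
        (measure_singleton (hitTime li 0 t x)))
      intro ξ hξ
      exact (show hitTime li 0 t x = hitTime lj 0 t ξ from hξ).symm
    have h2 : ∀ᵐ q : ℝ × ℝ ∂((volume.restrict (Ioo 0 1)).prod (volume.restrict (Ioo 0 1))),
        q ∈ Ioo (0 : ℝ) 1 ×ˢ Ioo (0 : ℝ) 1 := by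
      rw [Measure.prod_restrict]
      exact ae_restrict_mem (measurableSet_Ioo.prod measurableSet_Ioo)
    filter_upwards [h1, h2] with q hq1 hq2
    exact ⟨hq2, hh.eq_explicitKernel hl i j ht (Ioo_subset_Icc_self hq2.1) (Or.inr hq2.1.1) hq2.2
      hq1⟩
  constructor
  · refine AEStronglyMeasurable.congr (Measurable.aestronglyMeasurable ?_)
      (hae.mono fun q hq => hq.2.symm)
    unfold explicitKernel
    refine Measurable.ite (isOpen_lt hcj hci).measurableSet ?_ measurable_const
    refine Measurable.mul (Measurable.neg (Measurable.div ?_ ?_)) (Continuous.measurable ?_)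
    · refine ((hg i j).continuous_stripExtend.comp (f := fun q : ℝ × ℝ =>
        (hitTime lj 0 t q.2, flow li t q.1 (hitTime lj 0 t q.2))) ?_).measurable
      exact hcj.prodMk (hi.continuous_flow.comp
        (f := fun q : ℝ × ℝ => (t, q.1, hitTime lj 0 t q.2)) (by fun_prop))
    · exact (hj.continuous.comp (f := fun q : ℝ × ℝ => (hitTime lj 0 t q.2, (0 : ℝ)))
        (by fun_prop)).measurable
    · refine Real.continuous_exp.comp
        (intervalIntegral.continuous_parametric_intervalIntegral_of_continuous ?_ hcj)
      refine hj.continuous_deriv.comp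
        (f := fun q : (ℝ × ℝ) × ℝ => (q.2, flow lj t q.1.2 q.2)) ?_
      exact continuous_snd.prodMk (hj.continuous_flow.comp
        (f := fun q : (ℝ × ℝ) × ℝ => (t, q.1.2, q.2)) (by fun_prop))
  -- Here `|λ_j| ≥ ε` bounds the quotient, and a distance at most `1` at speed at least `ε` bounds
  -- the time to exit by `ε⁻¹`.
  · refine ⟨M / ε * Real.exp (K * ε⁻¹), hae.mono fun q hq => ?_⟩
    rw [hq.2, explicitKernel]
    split_ifs with hlt
    · rw [norm_mul, norm_neg, norm_div, Real.norm_eq_abs (Real.exp _), Real.abs_exp]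
      have hK := hj.K_nonneg
      have h1 : |hitTime lj 0 t q.2 - t| ≤ ε⁻¹ := by
        have h2 := hj.mul_abs_sub_le t q.2 (hitTime lj 0 t q.2) t
        rw [hj.flow_hitTime, hj.flow_self, zero_sub, abs_neg, abs_of_pos hq.1.2.1] at h2
        rw [inv_eq_one_div, le_div_iff₀ hε, mul_comm]
        exact h2.trans hq.1.2.2.le
      gcongr
      · exact hM _ _
      · have := hj.lt_neg (hitTime lj 0 t q.2) 0
        exact le_trans (by linarith) (neg_le_abs _)
      · have h3 := intervalIntegral.norm_integral_le_of_norm_le_const (a := t)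
          (b := hitTime lj 0 t q.2) (f := fun r => deriv (lj r) (flow lj t q.2 r))
          (fun r _ => hj.deriv_bound r (flow lj t q.2 r))
        exact (le_abs_self _).trans (h3.trans (by gcongr))
    · rw [norm_zero]; positivity

end IsKernelSolution

/-! ### Continuity with values in L² and null sets of entry times -/

lemma ContL2.sub {S A : Set ℝ} {f g : ℝ → ℝ → ℝ} (hf : ContL2 S A f) (hg : ContL2 S A g) :
    ContL2 S A fun t x => f t x - g t x := by
  refine ⟨fun t ht => (hf.1 t ht).sub (hg.1 t ht), fun t ht => ?_⟩
  have h := (hf.2 t ht).add (hg.2 t ht)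
  rw [add_zero] at h
  refine tendsto_of_tendsto_of_tendsto_of_le_of_le' tendsto_const_nhds h
    (Eventually.of_forall fun _ => zero_le) ?_
  filter_upwards [self_mem_nhdsWithin] with s hs
  have e : (fun x => f s x - g s x - (f t x - g t x))
      = (fun x => f s x - f t x) - fun x => g s x - g t x := by
    funext x; simp only [Pi.sub_apply]; ring
  rw [e]
  exact eLpNorm_sub_le ((hf.1 s hs).sub (hf.1 t ht)).1 ((hg.1 s hs).sub (hg.1 t ht)).1 (by norm_num)

lemma ContL2.congr {S A : Set ℝ} {f g : ℝ → ℝ → ℝ} (hf : ContL2 S A f)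
    (h : ∀ t ∈ S, f t =ᵐ[volume.restrict A] g t) : ContL2 S A g := by
  refine ⟨fun t ht => (hf.1 t ht).ae_eq (h t ht), fun t ht => ?_⟩
  refine (hf.2 t ht).congr' ?_
  filter_upwards [self_mem_nhdsWithin] with s hs
  exact eLpNorm_congr_ae ((h s hs).sub (h t ht))

lemma memLp_of_continuous_Ioo {w : ℝ → ℝ} (hw : Continuous w) (a b : ℝ) :
    MemLp w 2 (volume.restrict (Ioo a b)) := by
  obtain ⟨c, hc⟩ := (isCompact_Icc (a := a) (b := b)).exists_bound_of_continuousOn hw.continuousOn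
  refine MemLp.of_bound hw.aestronglyMeasurable c ?_
  filter_upwards [ae_restrict_mem measurableSet_Ioo] with x hx
  exact hc x (Ioo_subset_Icc_self hx)

/-- Compactness of `[a,b]` makes nearby slices uniformly close, and a uniform bound `δ` costs at
most `c * δ` in L², with `c` the square root of the length. -/
lemma contL2_of_continuous {w : ℝ → ℝ → ℝ} (hw : Continuous fun q : ℝ × ℝ => w q.1 q.2)
    (S : Set ℝ) (a b : ℝ) : ContL2 S (Ioo a b) w := by
  refine ⟨fun t _ => memLp_of_continuous_Ioo
    (hw.comp (f := fun x : ℝ => (t, x)) (by fun_prop)) a b, fun t _ => ?_⟩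
  refine Tendsto.mono_left ?_ nhdsWithin_le_nhds
  set c := (volume.restrict (Ioo a b) univ) ^ ((2 : ENNReal).toReal)⁻¹ with hc
  have hc' : c ≠ ⊤ := ENNReal.rpow_ne_top_of_nonneg (by norm_num) (by simp)
  rw [ENNReal.tendsto_nhds_zero]
  intro η hη
  obtain ⟨δ, hδ, hδη⟩ : ∃ δ : ℝ, 0 < δ ∧ c * ENNReal.ofReal δ ≤ η := by
    have h1 : Tendsto (fun δ : ℝ => c * ENNReal.ofReal δ) (𝓝[>] 0) (𝓝 0) := by
      have := ENNReal.Tendsto.const_mul (a := c)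
        ((ENNReal.continuous_ofReal.tendsto 0).mono_left (nhdsWithin_le_nhds (s := Ioi 0)))
        (Or.inr hc')
      simpa using this
    obtain ⟨δ, h2, h3⟩ := (((ENNReal.tendsto_nhds_zero.1 h1) η hη).and self_mem_nhdsWithin).exists
    exact ⟨δ, h3, h2⟩
  obtain ⟨V, hV, hVw⟩ := (isCompact_Icc (a := a) (b := b)).mem_uniformity_of_prod (f := w)
    (s := univ) (q := t) hw.continuousOn (mem_univ _) (Metric.dist_mem_uniformity hδ)
  rw [nhdsWithin_univ] at hV
  filter_upwards [hV] with s hs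
  refine (eLpNorm_le_of_ae_bound (C := δ) ?_).trans hδη
  filter_upwards [ae_restrict_mem measurableSet_Ioo] with x hx
  have := hVw s hs x (Ioo_subset_Icc_self hx)
  exact le_of_lt this

/-- The gain identity holds only for almost every time, while the boundary term evaluates it at the
entry time of `(t,x)`. Fubini reduces the exceptional set to null preimages at fixed `t`. -/
lemma NegativeSpeed.ae_hitTime {l : ℝ → ℝ → ℝ} {C K ε : ℝ} (hl : NegativeSpeed l C K ε) (y : ℝ)
    {P : ℝ → Prop} (hP : ∀ᵐ σ : ℝ, P σ) : ∀ᵐ q : ℝ × ℝ, P (hitTime l y q.1 q.2) := by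
  set N := toMeasurable volume {σ | ¬P σ} with hN
  have hN0 : volume N = 0 := by rw [hN, measure_toMeasurable]; exact hP
  have hms : MeasurableSet {q : ℝ × ℝ | hitTime l y q.1 q.2 ∈ N} :=
    (hl.continuous_hitTime y).measurable (measurableSet_toMeasurable _ _)
  have h0 : volume {q : ℝ × ℝ | hitTime l y q.1 q.2 ∈ N} = 0 := by
    rw [Measure.volume_eq_prod, Measure.measure_prod_null hms]
    exact Eventually.of_forall fun t => hl.volume_preimage_hitTime y t hN0
  refine measure_mono_null ?_ h0
  intro q hq
  exact subset_toMeasurable _ _ hq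

/-! ### The gain identity at `x = 1` -/

section Kernel

variable {m p : ℕ} (h : ℝ → ℝ → ℝ → Matrix (Fin m) (Fin m) ℝ)

lemma fullKernel_mulVec_inl (t x ξ : ℝ) (v : StateIdx m p → ℝ) (i : Fin m) :
    (fullKernel h t x ξ).mulVec v (Sum.inl i) = ∑ j, h t x ξ i j * v (Sum.inl j) := by
  simp [fullKernel, Matrix.mulVec, dotProduct, Fintype.sum_sum_type]

lemma fullKernel_mulVec_inr (t x ξ : ℝ) (v : StateIdx m p → ℝ) (i : Fin p) :
    (fullKernel h t x ξ).mulVec v (Sum.inr i) = 0 := by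
  simp [fullKernel, Matrix.mulVec, dotProduct, Fintype.sum_sum_type]

lemma fredholmSlice_fullKernel_inr (t : ℝ) (v : ℝ → StateIdx m p → ℝ) (x : ℝ) (k : Fin p) :
    fredholmSlice (fullKernel h t) v x (Sum.inr k) = v x (Sum.inr k) := by
  simp [fredholmSlice, fullKernel_mulVec_inr]

lemma mul_fullKernel_inl (A : Matrix (Fin m) (StateIdx m p) ℝ) (t x ξ : ℝ) (k l : Fin m) :
    (A * (fullKernel h t x ξ : Matrix (StateIdx m p) (StateIdx m p) ℝ)) k (Sum.inl l) = ∑ j, A k (Sum.inl j) * h t x ξ j l := by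
  simp [fullKernel, Matrix.mul_apply, Fintype.sum_sum_type]

lemma mul_fullKernel_inr (A : Matrix (Fin m) (StateIdx m p) ℝ) (t x ξ : ℝ) (k : Fin m)
    (l : Fin p) : (A * (fullKernel h t x ξ : Matrix (StateIdx m p) (StateIdx m p) ℝ)) k (Sum.inr l) = 0 := by
  simp [fullKernel, Matrix.mul_apply, Fintype.sum_sum_type]

variable {h}

lemma fredholmSlice_fullKernel_inl {t x : ℝ} {v : ℝ → StateIdx m p → ℝ} {i : Fin m}
    (hint : ∀ j, IntegrableOn (fun ξ => h t x ξ i j * v ξ (Sum.inl j)) (Ioo 0 1)) :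
    fredholmSlice (fullKernel h t) v x (Sum.inl i)
      = v x (Sum.inl i) - ∑ j, ∫ ξ in (0 : ℝ)..1, h t x ξ i j * v ξ (Sum.inl j) := by
  simp only [fredholmSlice, fullKernel_mulVec_inl]
  rw [intervalIntegral.integral_finsetSum]
  intro j _
  rw [intervalIntegrable_iff_integrableOn_Ioo_of_le zero_le_one]
  exact hint j

end Kernel

lemma intervalIntegral_zero_one_eq (f : ℝ → ℝ) :
    ∫ ξ in (0 : ℝ)..1, f ξ = ∫ ξ in Ioo (0 : ℝ) 1, f ξ := by
  rw [intervalIntegral.integral_of_le zero_le_one, integral_Ioc_eq_integral_Ioo]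

/-- The gain reproduces, by Fubini's theorem, the trace of the kernel at `x = 1`. -/
lemma IsGainSolution.ae_sum_integral_eq {m p : ℕ} {Λ : StateIdx m p → ℝ → ℝ → ℝ}
    {g : ℝ → ℝ → Matrix (Fin m) (Fin m) ℝ}
    {h : ℝ → ℝ → ℝ → Matrix (Fin m) (Fin m) ℝ} {C K ε : ℝ} (hh : IsKernelSolution Λ g h)
    (hl : ∀ i : Fin m, NegativeSpeed (Λ (Sum.inl i)) C K ε)
    (hg : ∀ i j, ContBddStrip fun t x => g t x i j)
    {F : ℝ → ℝ → Matrix (Fin m) (StateIdx m p) ℝ} (hF : IsGainSolution (fullKernel h) F) :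
    ∀ᵐ σ ∂(volume.restrict (Ioi 0)), ∀ (k : Fin m) (v : ℝ → StateIdx m p → ℝ),
      (∀ j, IntegrableOn (fun ξ => v ξ (Sum.inl j)) (Ioo 0 1)) →
      ∑ j, ∫ ξ in (0 : ℝ)..1, F σ ξ k j * fredholmSlice (fullKernel h σ) v ξ j
        = -∑ l, ∫ ξ in (0 : ℝ)..1, h σ 1 ξ k l * v ξ (Sum.inl l) := by
  have hbd := hF.bounded
  have heq := hF.equation
  simp only [EssBddStrip] at hbd
  simp only [Measure.volume_eq_prod, ← Measure.prod_restrict] at hbd heq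
  have h1 : ∀ᵐ σ ∂(volume.restrict (Ioi (0 : ℝ))), ∀ (k : Fin m) (j : StateIdx m p),
      AEStronglyMeasurable (fun ξ => F σ ξ k j) (volume.restrict (Ioo 0 1)) :=
    ae_all_iff.2 fun k => ae_all_iff.2 fun j => (hbd k j).1.prodMk_left
  have h2 : ∀ᵐ σ ∂(volume.restrict (Ioi (0 : ℝ))), ∀ (k : Fin m) (j : StateIdx m p),
      ∃ c, ∀ᵐ ξ ∂(volume.restrict (Ioo 0 1)), ‖F σ ξ k j‖ ≤ c := by
    refine ae_all_iff.2 fun k => ae_all_iff.2 fun j => ?_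
    obtain ⟨c, hc⟩ := eLpNormEssSup_lt_top_iff_isBoundedUnder.1
      (eLpNorm_exponent_top (f := fun q : ℝ × ℝ => F q.1 q.2 k j) ▸ (hbd k j).2)
    refine (Measure.ae_ae_of_ae_prod (eventually_map.1 hc)).mono fun σ hσ => ⟨c, ?_⟩
    exact hσ.mono fun ξ hξ => by exact_mod_cast hξ
  -- The null set of times is fixed before `v`, so that `v` may later be the slice of `z` at the
  -- same time `σ`.
  filter_upwards [h1, h2, Measure.ae_ae_of_ae_prod heq, ae_restrict_mem measurableSet_Ioi]
    with σ hFm hFb hFe hσ k v hv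
  have hσ0 : (0 : ℝ) ≤ σ := le_of_lt hσ
  set μ := (volume : Measure ℝ).restrict (Ioo 0 1) with hμ
  have hHm : ∀ j l, AEStronglyMeasurable (fun q : ℝ × ℝ => h σ q.1 q.2 j l) (μ.prod μ) :=
    fun j l => (hh.measurable_bounded_slice hl hg j l hσ0).1
  have hHb : ∀ j l, ∃ M, ∀ᵐ q : ℝ × ℝ ∂(μ.prod μ), ‖h σ q.1 q.2 j l‖ ≤ M :=
    fun j l => (hh.measurable_bounded_slice hl hg j l hσ0).2
  have hHv : ∀ j l, Integrable (fun q : ℝ × ℝ => h σ q.1 q.2 j l * v q.2 (Sum.inl l))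
      (μ.prod μ) := by
    intro j l
    obtain ⟨M, hM⟩ := hHb j l
    exact ((hv l).comp_snd μ).bdd_mul (hHm j l) hM
  have hFfst : ∀ j, AEStronglyMeasurable (fun q : ℝ × ℝ => F σ q.1 k j) (μ.prod μ) ∧
      ∃ c, ∀ᵐ q : ℝ × ℝ ∂(μ.prod μ), ‖F σ q.1 k j‖ ≤ c := by
    intro j
    obtain ⟨c, hc⟩ := hFb k j
    exact ⟨(hFm k j).comp_fst, c, Measure.quasiMeasurePreserving_fst.ae hc⟩
  have hFHv : ∀ j l, Integrable (fun q : ℝ × ℝ =>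
      F σ q.1 k (Sum.inl j) * (h σ q.1 q.2 j l * v q.2 (Sum.inl l))) (μ.prod μ) := by
    intro j l
    obtain ⟨hm, c, hc⟩ := hFfst (Sum.inl j)
    exact (hHv j l).bdd_mul hm hc
  have hFH : ∀ j l, Integrable (fun q : ℝ × ℝ => F σ q.1 k (Sum.inl j) * h σ q.1 q.2 j l)
      (μ.prod μ) := by
    intro j l
    obtain ⟨hm, c, hc⟩ := hFfst (Sum.inl j)
    obtain ⟨M, hM⟩ := hHb j l
    exact ((integrable_const M).mono' (hHm j l) hM).bdd_mul hm hc
  have hFv : ∀ j, Integrable (fun ξ => F σ ξ k (Sum.inl j) * v ξ (Sum.inl j)) μ := by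
    intro j
    obtain ⟨c, hc⟩ := hFb k (Sum.inl j)
    exact (hv j).bdd_mul (hFm k _) hc
  -- The positive columns of `H` vanish, so the gain equation forces the same columns of `F` to
  -- vanish almost everywhere.
  have hinr : ∀ j : Fin p, ∫ ξ in (0 : ℝ)..1,
      F σ ξ k (Sum.inr j) * fredholmSlice (fullKernel h σ) v ξ (Sum.inr j) = 0 := by
    intro j
    rw [intervalIntegral_zero_one_eq]
    refine integral_eq_zero_of_ae ?_
    filter_upwards [hFe] with ξ hξ
    have := hξ k (Sum.inr j)
    simp only [mul_fullKernel_inr, intervalIntegral.integral_zero, sub_zero] at this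
    rw [this]
    simp [fullKernel]
  have hinl : ∀ j : Fin m, ∫ ξ in (0 : ℝ)..1,
      F σ ξ k (Sum.inl j) * fredholmSlice (fullKernel h σ) v ξ (Sum.inl j)
      = (∫ ξ, F σ ξ k (Sum.inl j) * v ξ (Sum.inl j) ∂μ)
        - ∑ l, ∫ ζ, (∫ ξ, F σ ξ k (Sum.inl j) * h σ ξ ζ j l ∂μ) * v ζ (Sum.inl l) ∂μ := by
    intro j
    have hae : ∀ᵐ ξ ∂μ, F σ ξ k (Sum.inl j) * fredholmSlice (fullKernel h σ) v ξ (Sum.inl j)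
        = F σ ξ k (Sum.inl j) * v ξ (Sum.inl j)
          - ∑ l, ∫ ζ, F σ ξ k (Sum.inl j) * (h σ ξ ζ j l * v ζ (Sum.inl l)) ∂μ := by
      have hsl : ∀ᵐ ξ ∂μ, ∀ l, Integrable (fun ζ => h σ ξ ζ j l * v ζ (Sum.inl l)) μ :=
        ae_all_iff.2 fun l => (hHv j l).prod_right_ae
      filter_upwards [hsl] with ξ hξ
      rw [fredholmSlice_fullKernel_inl hξ, mul_sub, Finset.mul_sum]
      congr 1
      refine Finset.sum_congr rfl fun l _ => ?_
      rw [intervalIntegral_zero_one_eq, integral_const_mul]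
    rw [intervalIntegral_zero_one_eq, integral_congr_ae hae,
      integral_sub (hFv j) (integrable_finsetSum _ fun l _ => (hFHv j l).integral_prod_left),
      integral_finsetSum _ fun l _ => (hFHv j l).integral_prod_left]
    congr 1
    refine Finset.sum_congr rfl fun l _ => ?_
    rw [integral_integral_swap (hFHv j l)]
    refine integral_congr_ae (ae_of_all _ fun ζ => ?_)
    simp only
    rw [← integral_mul_const]
    refine integral_congr_ae (ae_of_all _ fun ξ => ?_)
    simp only
    ring
  have hFHvi : ∀ j l, Integrable
      (fun ζ => (∫ ξ, F σ ξ k (Sum.inl j) * h σ ξ ζ j l ∂μ) * v ζ (Sum.inl l)) μ := by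
    intro j l
    refine (hFHv j l).integral_prod_right.congr (ae_of_all _ fun ζ => ?_)
    simp only
    rw [← integral_mul_const]
    refine integral_congr_ae (ae_of_all _ fun ξ => ?_)
    simp only
    ring
  -- This is column `l` of the gain equation, multiplied by `v_l` and integrated.
  have hgain : ∀ l : Fin m, (∫ ξ, F σ ξ k (Sum.inl l) * v ξ (Sum.inl l) ∂μ)
      - ∑ j, ∫ ζ, (∫ ξ, F σ ξ k (Sum.inl j) * h σ ξ ζ j l ∂μ) * v ζ (Sum.inl l) ∂μ
      = -∫ ξ in (0 : ℝ)..1, h σ 1 ξ k l * v ξ (Sum.inl l) := by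
    intro l
    rw [← integral_finsetSum _ fun j _ => hFHvi j l,
      ← integral_sub (hFv l) (integrable_finsetSum _ fun j _ => hFHvi j l),
      intervalIntegral_zero_one_eq, ← integral_neg]
    refine integral_congr_ae ?_
    have hsl : ∀ᵐ ζ ∂μ, ∀ j, Integrable (fun ξ => F σ ξ k (Sum.inl j) * h σ ξ ζ j l) μ :=
      ae_all_iff.2 fun j => (hFH j l).prod_left_ae
    filter_upwards [hFe, hsl] with ζ hζ hζi
    have := hζ k (Sum.inl l)
    simp only [mul_fullKernel_inl] at this
    rw [intervalIntegral_zero_one_eq, integral_finsetSum _ fun j _ => hζi j] at this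
    have e : fullKernel (p := p) h σ 1 ζ (Sum.inl k) (Sum.inl l) = h σ 1 ζ k l := rfl
    rw [e] at this
    rw [← Finset.sum_mul, ← sub_mul, this, neg_mul]
  rw [Fintype.sum_sum_type]
  simp only [hinr, hinl, Finset.sum_const_zero, add_zero]
  rw [Finset.sum_sub_distrib, Finset.sum_comm, ← Finset.sum_sub_distrib, ← Finset.sum_neg_distrib]
  exact Finset.sum_congr rfl fun l _ => hgain l

/-! ### The transformed solution -/

/-- The characteristic enters after `t0` exactly when its position at `t0` exceeds `1`. The zero
extension of the datum therefore encodes the zero inflow, and one formula covers both cases. -/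
lemma IsBroadSolution.ae_eq_negative {m p : ℕ} {Λ : StateIdx m p → ℝ → ℝ → ℝ}
    {Q : ℝ → Matrix (Fin p) (Fin m) ℝ} {Gpm : ℝ → ℝ → Matrix (Fin p) (Fin m) ℝ} {t0 : ℝ}
    {z0 : ℝ → StateIdx m p → ℝ} {z : ℝ → ℝ → StateIdx m p → ℝ}
    (hz : IsBroadSolution Λ 0 (targetMatrix Gpm) 0 Q t0 z0 z) {C K ε : ℝ}
    (hl : ∀ i : Fin m, NegativeSpeed (Λ (Sum.inl i)) C K ε) (j : Fin m) :
    ∀ᵐ q : ℝ × ℝ ∂(volume.restrict (Ioi t0 ×ˢ Ioo 0 1)), z q.1 q.2 (Sum.inl j)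
      = (Ioc (0 : ℝ) 1).indicator (fun x => z0 x (Sum.inl j))
        (flow (Λ (Sum.inl j)) q.1 q.2 t0) := by
  have hj := hl j
  filter_upwards [hz.equation (Sum.inl j),
    ae_restrict_mem (measurableSet_Ioi.prod measurableSet_Ioo)] with q hq hmem
  obtain ⟨ht, hx⟩ : t0 < q.1 ∧ q.2 ∈ Ioo (0 : ℝ) 1 := hmem
  rw [hq]
  simp only [targetMatrix, Fintype.sum_sum_type, Matrix.fromBlocks_apply₁₁,
    Matrix.fromBlocks_apply₁₂, Pi.zero_apply, Matrix.zero_apply, zero_mul,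
    intervalIntegral.integral_zero, Finset.sum_const_zero, add_zero, inflowValue]
  have he : entryTime Λ (Sum.inl j) q.1 q.2 = hitTime (Λ (Sum.inl j)) 1 q.1 q.2 := rfl
  rw [he]
  split_ifs with h <;> rw [hj.lt_hitTime_iff] at h
  · rw [indicator_of_notMem fun h' => (not_lt.2 h'.2) h]
  · rw [indicator_of_mem]
    · rfl
    · refine ⟨hx.1.trans ?_, not_lt.1 h⟩
      have := hj.flow_strictAnti q.1 q.2 ht
      rwa [hj.flow_self] at this

theorem propositionA4 {m p : ℕ} (hm : 1 ≤ m) (hp : 1 ≤ p)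
    (Λ : StateIdx m p → ℝ → ℝ → ℝ) (hΛ : AdmissibleSpeeds Λ)
    (Q : ℝ → Matrix (Fin p) (Fin m) ℝ) (hQ : ∀ i j, ContBddHalfLine (fun t => Q t i j))
    (Gmm : ℝ → ℝ → Matrix (Fin m) (Fin m) ℝ)
    (hGmm : ∀ i j, ContBddStrip (fun t x => Gmm t x i j))
    (hGmm_tri : ∀ t ≥ 0, ∀ x ∈ Set.Icc (0 : ℝ) 1, ∀ i j, i ≤ j → Gmm t x i j = 0)
    (Gpm : ℝ → ℝ → Matrix (Fin p) (Fin m) ℝ)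
    (hGpm : ∀ i j, ContBddStrip (fun t x => Gpm t x i j))
    (h : ℝ → ℝ → ℝ → Matrix (Fin m) (Fin m) ℝ) (hh : IsKernelSolution Λ Gmm h)
    (F : ℝ → ℝ → Matrix (Fin m) (StateIdx m p) ℝ) (hF : IsGainSolution (fullKernel h) F)
    (t0 : ℝ) (ht0 : 0 ≤ t0)
    (z0 : ℝ → StateIdx m p → ℝ)
    (hz0 : ∀ i, MeasureTheory.MemLp (fun x => z0 x i) 2
      (MeasureTheory.volume.restrict (Set.Ioo 0 1)))
    (z : ℝ → ℝ → StateIdx m p → ℝ)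
    (hz : IsBroadSolution Λ 0 (targetMatrix Gpm) 0 Q t0 z0 z) :
    IsBroadSolution Λ 0 (sourceMatrix Gmm Gpm) F Q t0
      (fredholmSlice (fullKernel h t0) z0) (fredholmTransform (fullKernel h) z) := by
  obtain ⟨C, K, ε, hl⟩ := hΛ.exists_negativeSpeed
  set f : Fin m → ℝ → ℝ := fun j => (Ioc (0 : ℝ) 1).indicator fun x => z0 x (Sum.inl j) with hf
  have hfi : ∀ j, Integrable (f j) := by
    intro j
    rw [hf, integrable_indicator_iff measurableSet_Ioc, integrableOn_Ioc_iff_integrableOn_Ioo]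
    exact (hz0 (Sum.inl j)).integrable (by norm_num)
  have hfs : ∀ j x, x ∉ Ioc (0 : ℝ) 1 → f j x = 0 := fun j x hx => indicator_of_notMem hx _
  have hzq := fun j => hz.ae_eq_negative hl j
  have hzt : ∀ j t, t0 ≤ t → (fun x => z t x (Sum.inl j)) =ᵐ[volume.restrict (Ioo 0 1)]
      fun x => f j (flow (Λ (Sum.inl j)) t x t0) := fun j t ht =>
    (hl j).ae_eq_of_transported (y := fun t x => z t x (Sum.inl j)) (hfi j) (hzq j)
      (hz.regularity.cont_time (Sum.inl j)) ht
  set u : Fin m → ℝ → ℝ := fun j s => f j (flow (Λ (Sum.inl j)) s 0 t0) with hu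
  have hui : ∀ j, Integrable (u j) := fun j =>
    (hl j).integrable_flow_initialTime t0 (hfi j) (hfs j)
  have hzu : ∀ j, ∀ᵐ s ∂(volume.restrict (Ioi t0)), z s 0 (Sum.inl j) = u j s := fun j =>
    (hl j).ae_trace_eq_of_transported (y := fun t x => z t x (Sum.inl j)) (hfi j) (hzq j)
      (hz.regularity.cont_space (Sum.inl j))
  set g' : Fin m → Fin m → ℝ → ℝ → ℝ := fun i j => stripExtend fun t x => Gmm t x i j with hg'
  have hgc : ∀ i j, Continuous fun q : ℝ × ℝ => g' i j q.1 q.2 := fun i j =>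
    (hGmm i j).continuous_stripExtend
  choose M hM using fun i j => (hGmm i j).exists_abs_stripExtend_le
  -- the sum over `j` of the integrals of `h_{ij} z_j`
  set W : Fin m → ℝ → ℝ → ℝ := fun i t x =>
    ∑ j, outflowIntegral (Λ (Sum.inl i)) (g' i j) (u j) t x with hW
  have hWc : ∀ i, Continuous fun q : ℝ × ℝ => W i q.1 q.2 := fun i =>
    continuous_finsetSum _ fun j _ =>
      (hl i).continuous_outflowIntegral (hgc i j) (hM i j) (hui j)
  -- The slice `v` is kept general because the identity serves both for `z t` and for `z0` at time
  -- `t0`, which need not coincide pointwise.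
  have hslice : ∀ (v : ℝ → StateIdx m p → ℝ) (t x : ℝ), t0 ≤ t → x ∈ Icc (0 : ℝ) 1 →
      0 < t ∨ 0 < x →
      (∀ j, (fun ξ => v ξ (Sum.inl j)) =ᵐ[volume.restrict (Ioo 0 1)]
        fun ξ => f j (flow (Λ (Sum.inl j)) t ξ t0)) → ∀ i,
      (∑ j, ∫ ξ in (0 : ℝ)..1, h t x ξ i j * v ξ (Sum.inl j)) = W i t x ∧
      fredholmSlice (fullKernel h t) v x (Sum.inl i) = v x (Sum.inl i) - W i t x := by
    intro v t x ht hx htx hv i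
    have hk := fun j => hh.integral_mul_transported hl hGmm i j ht0 ht hx htx (hfi j) (hfs j) (hv j)
    have hs : (∑ j, ∫ ξ in (0 : ℝ)..1, h t x ξ i j * v ξ (Sum.inl j)) = W i t x :=
      Finset.sum_congr rfl fun j _ => (hk j).2
    exact ⟨hs, by rw [fredholmSlice_fullKernel_inl fun j => (hk j).1, hs]⟩
  set γ := fredholmTransform (fullKernel h) z with hγ
  have hγr : ∀ t x k, γ t x (Sum.inr k) = z t x (Sum.inr k) := fun t x k =>
    fredholmSlice_fullKernel_inr h t (z t) x k
  have hγl : ∀ t x, t0 ≤ t → x ∈ Icc (0 : ℝ) 1 → 0 < t ∨ 0 < x → ∀ i,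
      γ t x (Sum.inl i) = z t x (Sum.inl i) - W i t x := fun t x ht hx htx i =>
    (hslice (z t) t x ht hx htx (fun j => hzt j t ht) i).2
  -- Since the kernel vanishes at `x = 0`, the traces agree for every positive time.
  have hγ0 : ∀ s, 0 < s → ∀ i, γ s 0 (Sum.inl i) = z s 0 (Sum.inl i) := by
    intro s hs i
    change z s 0 (Sum.inl i) - _ = _
    rw [intervalIntegral_zero_one_eq, setIntegral_eq_zero_of_forall_eq_zero, sub_zero]
    intro ξ hξ
    rw [fullKernel_mulVec_inl]
    exact Finset.sum_eq_zero fun j _ => by rw [hh.eq_zero_of_left hl i j hs hξ, zero_mul]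
  have hflow0 : ∀ (j : Fin m) (x : ℝ), x ∈ Ioo (0 : ℝ) 1 →
      f j (flow (Λ (Sum.inl j)) t0 x t0) = z0 x (Sum.inl j) := fun j x hx => by
    rw [(hl j).flow_self, hf]
    exact indicator_of_mem (Ioo_subset_Ioc_self hx) _
  have hγ00 : ∀ x ∈ Ioc (0 : ℝ) 1, ∀ i,
      fredholmSlice (fullKernel h t0) z0 x (Sum.inl i) = z0 x (Sum.inl i) - W i t0 x := by
    intro x hx i
    refine (hslice z0 t0 x le_rfl (Ioc_subset_Icc_self hx) (Or.inr hx.1) (fun j => ?_) i).2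
    filter_upwards [ae_restrict_mem measurableSet_Ioo] with ξ hξ
    exact (hflow0 j ξ hξ).symm
  refine ⟨?_, ⟨?_, ?_, ?_⟩, ?_⟩
  · rintro (i | k)
    · refine MemLp.ae_eq ?_ ((hz0 (Sum.inl i)).sub (memLp_of_continuous_Ioo
        ((hWc i).comp (f := fun x : ℝ => (t0, x)) (by fun_prop)) 0 1))
      filter_upwards [ae_restrict_mem measurableSet_Ioo] with x hx
      exact (hγ00 x (Ioo_subset_Ioc_self hx) i).symm
    · simpa only [fredholmSlice_fullKernel_inr] using hz0 (Sum.inr k)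
  · rintro (i | k)
    · refine ((hz.regularity.measurable (Sum.inl i)).sub
        (hWc i).aestronglyMeasurable).congr ?_
      filter_upwards [ae_restrict_mem (measurableSet_Ioi.prod measurableSet_Ioo)] with q hq
      exact (hγl q.1 q.2 (le_of_lt hq.1) (Ioo_subset_Icc_self hq.2) (Or.inr hq.2.1) i).symm
    · simpa only [hγr] using hz.regularity.measurable (Sum.inr k)
  · rintro (i | k) T hT
    · refine ((hz.regularity.cont_time (Sum.inl i) T hT).sub
        (contL2_of_continuous (hWc i) _ 0 1)).congr fun t ht => ?_
      filter_upwards [ae_restrict_mem measurableSet_Ioo] with x hx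
      exact (hγl t x ht.1 (Ioo_subset_Icc_self hx) (Or.inr hx.1) i).symm
    · simpa only [hγr] using hz.regularity.cont_time (Sum.inr k) T hT
  · rintro (i | k) T hT
    · refine ((hz.regularity.cont_space (Sum.inl i) T hT).sub
        (contL2_of_continuous (w := fun x t => W i t x) ((hWc i).comp continuous_swap)
          _ t0 (t0 + T))).congr fun x hx => ?_
      filter_upwards [ae_restrict_mem measurableSet_Ioo] with t ht
      exact (hγl t x ht.1.le hx (Or.inl (ht0.trans_lt ht.1)) i).symm
    · simpa only [hγr] using hz.regularity.cont_space (Sum.inr k) T hT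
  · rintro (i | k)
    · have hi := hl i
      have hgain := (ae_restrict_iff' measurableSet_Ioi).1 (hF.ae_sum_integral_eq hh hl hGmm)
      have hzu' : ∀ᵐ s : ℝ, ∀ j, t0 < s → z s 0 (Sum.inl j) = u j s :=
        ae_all_iff.2 fun j => (ae_restrict_iff' measurableSet_Ioi).1 (hzu j)
      filter_upwards [hzq i, ae_restrict_mem (measurableSet_Ioi.prod measurableSet_Ioo),
        ae_restrict_of_ae (hi.ae_hitTime 1 hgain)] with q hq hmem hgq
      obtain ⟨t, x⟩ := q
      obtain ⟨ht, hx⟩ : t0 < t ∧ x ∈ Ioo (0 : ℝ) 1 := hmem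
      simp only at hq hgq ⊢
      have he : entryTime Λ (Sum.inl i) t x = hitTime (Λ (Sum.inl i)) 1 t x := rfl
      set σ := hitTime (Λ (Sum.inl i)) 1 t x with hσ
      have hσt : σ < t := by
        rw [hσ, hi.hitTime_lt_iff, hi.flow_self]; exact hx.2
      have hs0t : max t0 σ < t := max_lt ht hσt
      -- the source term
      have hsrc : ∀ j, ∫ s in (max t0 σ)..t, Gmm s (flow (Λ (Sum.inl i)) t x s) i j
            * γ s 0 (Sum.inl j)
          = ∫ s in (max t0 σ)..t, g' i j s (flow (Λ (Sum.inl i)) t x s) * u j s := by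
        intro j
        refine intervalIntegral.integral_congr_ae ?_
        filter_upwards [hzu'] with s hs hsm
        rw [uIoc_of_le hs0t.le] at hsm
        have h1 : t0 < s := (le_max_left _ _).trans_lt hsm.1
        have h2 : σ < s := (le_max_right _ _).trans_lt hsm.1
        have hχ : flow (Λ (Sum.inl i)) t x s ∈ Icc (0 : ℝ) 1 := by
          refine ⟨?_, ((hi.hitTime_lt_iff 1 t x s).1 h2).le⟩
          have := (hi.flow_strictAnti t x).antitone hsm.2
          rw [hi.flow_self] at this
          exact hx.1.le.trans this
        have hge : g' i j s (flow (Λ (Sum.inl i)) t x s) = Gmm s (flow (Λ (Sum.inl i)) t x s) i j :=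
          stripExtend_eq _ (ht0.trans h1.le) hχ
        rw [hγ0 s (ht0.trans_lt h1), hs j h1, hge]
      -- Between the start of the characteristic and `(t,x)`, the loss of `W` is exactly the source
      -- term.
      have hWflow : W i (max t0 σ) (flow (Λ (Sum.inl i)) t x (max t0 σ))
          = (∑ j, ∫ s in (max t0 σ)..t, g' i j s (flow (Λ (Sum.inl i)) t x s) * u j s)
            + W i t x := by
        rw [hW, ← Finset.sum_add_distrib]
        exact Finset.sum_congr rfl fun j _ =>
          hi.outflowIntegral_flow (hgc i j) (hM i j) (hui j) t x _
      rw [hγl t x ht.le (Ioo_subset_Icc_self hx) (Or.inr hx.1)]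
      simp only [sourceMatrix, Fintype.sum_sum_type, Matrix.fromBlocks_apply₁₁,
        Matrix.fromBlocks_apply₁₂, Pi.zero_apply, Matrix.zero_apply, zero_mul,
        intervalIntegral.integral_zero, Finset.sum_const_zero, add_zero, entryTimeFrom, he, chi]
      rw [Finset.sum_congr rfl fun j _ => hsrc j, inflowValue, he, hq]
      split_ifs with hc
      -- Entry through `x = 1` after `t0`: `z_i` is zero on this characteristic and the feedback
      -- supplies `-W_i(σ,1)`.
      · have hσ1 : flow (Λ (Sum.inl i)) t x σ = 1 := hi.flow_hitTime 1 t x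
        rw [max_eq_right hc.le] at hWflow ⊢
        rw [hσ1] at hWflow
        have hb := hgq (ht0.trans_lt hc) i (z σ) fun j =>
          ((hz.regularity.cont_time (Sum.inl j) (σ - t0) (sub_pos.2 hc)).1 σ
            ⟨hc.le, by linarith⟩).integrable (by norm_num)
        rw [(hslice (z σ) σ 1 hc.le (right_mem_Icc.2 zero_le_one) (Or.inr one_pos)
          (fun j => hzt j σ hc.le) i).1] at hb
        change _ = (∑ j, ∫ ξ in (0 : ℝ)..1, F σ ξ i j * fredholmSlice (fullKernel h σ) (z σ) ξ j)
          + _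
        rw [hb, hWflow, indicator_of_notMem fun h' => (not_lt.2 h'.2) ((hi.lt_hitTime_iff 1 t x t0).1 hc)]
        ring
      · rw [max_eq_left (not_lt.1 hc)] at hWflow ⊢
        have hy : flow (Λ (Sum.inl i)) t x t0 ∈ Ioc (0 : ℝ) 1 := by
          refine ⟨hx.1.trans ?_, not_lt.1 fun h' => hc ((hi.lt_hitTime_iff 1 t x t0).2 h')⟩
          have := hi.flow_strictAnti t x ht
          rwa [hi.flow_self] at this
        change _ = fredholmSlice (fullKernel h t0) z0 (flow (Λ (Sum.inl i)) t x t0) (Sum.inl i) + _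
        rw [hγ00 _ hy, hWflow, indicator_of_mem hy]
        ring
    -- Positive rows of `H` vanish, the two source matrices share their lower blocks, and only
    -- traces at `x = 0` enter, so the equation of `z` carries over.
    · filter_upwards [hz.equation (Sum.inr k),
        ae_restrict_mem (measurableSet_Ioi.prod measurableSet_Ioo)] with q hq hmem
      have ht : t0 < q.1 := hmem.1
      rw [hγr, hq]
      congr 1
      · congr 1
        · unfold inflowValue
          split_ifs with hc
          · simp only [hγ0 _ (ht0.trans_lt hc)]
          · rw [fredholmSlice_fullKernel_inr]
        · simp
      · simp only [targetMatrix, sourceMatrix, Fintype.sum_sum_type, Matrix.fromBlocks_apply₂₁,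
          Matrix.fromBlocks_apply₂₂, Matrix.zero_apply, zero_mul]
        congr 1
        refine Finset.sum_congr rfl fun j _ => intervalIntegral.integral_congr_ae
          (ae_of_all _ fun s hs => ?_)
        have h1 : t0 < s :=
          (le_min (le_max_left _ _) ht.le).trans_lt hs.1
        rw [hγ0 s (ht0.trans_lt h1)]

end
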